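/- Let $m, I, \delta > 0$ (for the planar three balls bearing, $m$ is the mass of the moving plane, $I$ its moment of inertia about the vertical axis through its mass centre, and $\delta=\sum_{i=1}^3\frac{m_ir^2+I_i}{4r^2}$, where $r$ is the radius of the balls and $m_i, I_i$ their masses and moments of inertia). On $$\mathcal Q=\{(v_x,v_y,v_\varphi,N_1,N_2,M)\in\mathbb R^6 : \delta M>N_1^2+N_2^2\}$$ put $\mathbf v=(v_x,v_y,v_\varphi)$, $\mathbf n=(N_1,N_2,M)$, $\mathbf m=\frac12\big(N_1v_\varphi^2-\delta v_\varphi v_y,\ N_2v_\varphi^2+\delta v_\varphi v_x,\ v_\varphi(N_1v_x+N_2v_y)\big)$, $$\mathbb I=\begin{pmatrix} m+\delta&0&-N_2\\0&m+\delta&N_1\\-N_2&N_1&I+M\end{pmatrix},\qquad \mathbb J=-\frac12\begin{pmatrix}\delta&0&N_2\\0&\delta&-N_1\\2N_1&2N_2&0\end{pmatrix}.$$ The matrix $\mathbb I$ is invertible on $\mathcal Q$, and the reduced planar three balls bearing equations are $$\dot{\mathbf v}=\mathbb I^{-1}\mathbf m,\qquad \dot{\mathbf n}=\mathbb J\mathbf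 v .$$ (i) The following functions are first integrals of this system on $\mathcal Q$, and their differentials are linearly independent on a dense subset of $\mathcal Q$: $$f_1=(m+\delta)v_x-v_\varphi N_2,\qquad f_2=(m+\delta)v_y+v_\varphi N_1,\qquad f_3=\delta M-(N_1^2+N_2^2),$$ $$f_4=\tfrac12(I+M)v_\varphi^2+\tfrac12(m+\delta)(v_x^2+v_y^2)+v_\varphi(N_1v_y-N_2v_x).$$ (ii) The flow of the system preserves the measure $\sqrt{\det(\mathbb I)}\,dv_x\wedge dv_y\wedge dv_\varphi\wedge dN_1\wedge dN_2\wedge dM$ on $\mathcal Q$. (iii) The system can be solved by quadratures: near every point of $\mathcal Q$ the local flow $\Phi(t,x)$ (the solution at time $t$ with initial value $x$) is obtained, as a function of the time $t$ with the initial values $x$ as parameters, from $t$, the coordinates of $x$ and real constants by finitely many algebraic operations, compositions, inversions of functions and quadratures (integrals of functions already obtained), where composition, inversion and integration are with respect to the time variable. -/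

import Mathlib

open Set Filter Topology MeasureTheory

noncomputable section

namespace BallBearing

/-! ### General notions for an autonomous system `ẋ = X x` on a region `Q ⊆ ℝⁿ` -/

/-- `γ` is a solution of `ẋ = X x` on the time set `J` (an interval in all uses below) that stays
in `Q`. -/
def IsSolutionOn {n : ℕ} (X : (Fin n → ℝ) → (Fin n → ℝ)) (Q : Set (Fin n → ℝ))
    (γ : ℝ → (Fin n → ℝ)) (J : Set ℝ) : Prop :=
  IsIntegralCurveOn γ (fun _ => X) J ∧ ∀ t ∈ J, γ t ∈ Q

/-- `f` is constant along every solution in `Q`. -/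
def IsFirstIntegral {n : ℕ} (X : (Fin n → ℝ) → (Fin n → ℝ)) (Q : Set (Fin n → ℝ))
    (f : (Fin n → ℝ) → ℝ) : Prop :=
  ∀ (J : Set ℝ) (γ : ℝ → (Fin n → ℝ)), J.OrdConnected → IsSolutionOn X Q γ J →
    ∀ s ∈ J, ∀ t ∈ J, f (γ s) = f (γ t)

/-- Functional independence: the differentials are linearly independent on a dense subset
of `Q`. -/
def FunctionallyIndependentOn {n k : ℕ} (f : Fin k → (Fin n → ℝ) → ℝ)
    (Q : Set (Fin n → ℝ)) : Prop :=
  Q ⊆ closure {x | x ∈ Q ∧ LinearIndependent ℝ (fun i => fderiv ℝ (f i) x)}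

/-- The measure `ν` is preserved by the (possibly only partially defined) flow of `X` on `Q`:
whenever all the solutions that start in the measurable set `B` exist up to the time `T`
(which may be negative), the set of their end points has the same measure as `B`. -/
def IsInvariantMeasure {n : ℕ} (X : (Fin n → ℝ) → (Fin n → ℝ)) (Q : Set (Fin n → ℝ))
    (ν : Measure (Fin n → ℝ)) : Prop :=
  ∀ (B : Set (Fin n → ℝ)) (T : ℝ) (Φ : ℝ → (Fin n → ℝ) → (Fin n → ℝ)), MeasurableSet B →
    (∀ x ∈ B, Φ 0 x = x ∧ IsSolutionOn X Q (fun t => Φ t x) (uIcc 0 T)) →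
    ν (Φ T '' B) = ν B

/-- `ByQuadratures x₀ t₀ f`: near `(t₀, x₀)`, the function `f t x` of the time `t`, depending on
the parameters `x = (x₁, …, xₙ)`, is obtained from `t`, `x₁, …, xₙ` and real constants by finitely
many algebraic operations (arithmetic and the solution of algebraic equations at simple roots),
compositions, inversions of functions, and quadratures (integrals of functions already obtained),
where composition, inversion and integration are with respect to the time variable, with the
parameters held fixed. -/
inductive ByQuadratures {n : ℕ} (x₀ : Fin n → ℝ) : ℝ → (ℝ → (Fin n → ℝ) → ℝ) → Prop
  | time (t₀ : ℝ) : ByQuadratures x₀ t₀ (fun t _ => t)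
  | param (t₀ : ℝ) (i : Fin n) : ByQuadratures x₀ t₀ (fun _ x => x i)
  | const (t₀ c : ℝ) : ByQuadratures x₀ t₀ (fun _ _ => c)
  | congr {t₀ : ℝ} {f g : ℝ → (Fin n → ℝ) → ℝ} (hf : ByQuadratures x₀ t₀ f)
      (h : ∀ᶠ p : ℝ × (Fin n → ℝ) in 𝓝 (t₀, x₀), g p.1 p.2 = f p.1 p.2) :
      ByQuadratures x₀ t₀ g
  | add {t₀ : ℝ} {f g : ℝ → (Fin n → ℝ) → ℝ} (hf : ByQuadratures x₀ t₀ f)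
      (hg : ByQuadratures x₀ t₀ g) : ByQuadratures x₀ t₀ (fun t x => f t x + g t x)
  | mul {t₀ : ℝ} {f g : ℝ → (Fin n → ℝ) → ℝ} (hf : ByQuadratures x₀ t₀ f)
      (hg : ByQuadratures x₀ t₀ g) : ByQuadratures x₀ t₀ (fun t x => f t x * g t x)
  | inv {t₀ : ℝ} {f : ℝ → (Fin n → ℝ) → ℝ} (hf : ByQuadratures x₀ t₀ f)
      (h : f t₀ x₀ ≠ 0) : ByQuadratures x₀ t₀ (fun t x => (f t x)⁻¹)
  /-- A continuous simple root `g` of `∑_{i ≤ d} aᵢ zⁱ`. -/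
  | root {t₀ : ℝ} (d : ℕ) {a : ℕ → ℝ → (Fin n → ℝ) → ℝ} {g : ℝ → (Fin n → ℝ) → ℝ}
      (ha : ∀ i, ByQuadratures x₀ t₀ (a i))
      (hg : ContinuousAt (fun p : ℝ × (Fin n → ℝ) => g p.1 p.2) (t₀, x₀))
      (h : ∀ᶠ p : ℝ × (Fin n → ℝ) in 𝓝 (t₀, x₀),
        ∑ i ∈ Finset.range (d + 1), a i p.1 p.2 * g p.1 p.2 ^ i = 0)
      (hs : ∑ i ∈ Finset.range (d + 1), (i : ℝ) * a i t₀ x₀ * g t₀ x₀ ^ (i - 1) ≠ 0) :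
      ByQuadratures x₀ t₀ g
  | comp {t₀ : ℝ} {f g : ℝ → (Fin n → ℝ) → ℝ} (hg : ByQuadratures x₀ t₀ g)
      (hf : ByQuadratures x₀ (g t₀ x₀) f) : ByQuadratures x₀ t₀ (fun t x => f (g t x) x)
  /-- For each `x`, the function `g (·, x)` is the local inverse of `f (·, x)`. -/
  | inverse {t₀ s₀ : ℝ} {f g : ℝ → (Fin n → ℝ) → ℝ} (hf : ByQuadratures x₀ s₀ f)
      (hd : deriv (fun s => f s x₀) s₀ ≠ 0)
      (hg : ContinuousAt (fun p : ℝ × (Fin n → ℝ) => g p.1 p.2) (t₀, x₀))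
      (h₀ : g t₀ x₀ = s₀)
      (h : ∀ᶠ p : ℝ × (Fin n → ℝ) in 𝓝 (t₀, x₀), f (g p.1 p.2) p.2 = p.1) :
      ByQuadratures x₀ t₀ g
  | integral {t₀ : ℝ} {f : ℝ → (Fin n → ℝ) → ℝ} (hf : ByQuadratures x₀ t₀ f) :
      ByQuadratures x₀ t₀ (fun t x => ∫ s in t₀..t, f s x)

/-- The system `ẋ = X x` on `Q` is solvable by quadratures: near every `x₀ ∈ Q` there is a local
flow `Φ t x` (the solution at time `t` with the initial value `x`) all of whose components are
obtained by quadratures, as functions of the time with the initial values as parameters. -/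
def SolvableByQuadratures {n : ℕ} (X : (Fin n → ℝ) → (Fin n → ℝ)) (Q : Set (Fin n → ℝ)) :
    Prop :=
  ∀ x₀ ∈ Q, ∃ Φ : ℝ → (Fin n → ℝ) → (Fin n → ℝ),
    (∀ᶠ x in 𝓝 x₀, Φ 0 x = x) ∧
    (∀ᶠ p : ℝ × (Fin n → ℝ) in 𝓝 (0, x₀),
      Φ p.1 p.2 ∈ Q ∧ HasDerivAt (fun t => Φ t p.2) (X (Φ p.1 p.2)) p.1) ∧
    ∀ i, ByQuadratures x₀ 0 (fun t x => Φ t x i)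

/-! ### The reduced planar three balls bearing system

A point of `ℝ⁶` is `x = (v_x, v_y, v_φ, N₁, N₂, M)`. -/

/-- The phase space `δ M > N₁² + N₂²`. -/
def phaseSpace (δ : ℝ) : Set (Fin 6 → ℝ) := {x | x 3 ^ 2 + x 4 ^ 2 < δ * x 5}

/-- The matrix `𝕀`. -/
def inertia (m I δ : ℝ) (x : Fin 6 → ℝ) : Matrix (Fin 3) (Fin 3) ℝ :=
  !![m + δ, 0, -x 4;
     0, m + δ, x 3;
     -x 4, x 3, I + x 5]

/-- The matrix `𝕁`. -/
def kinematicMatrix (δ : ℝ) (x : Fin 6 → ℝ) : Matrix (Fin 3) (Fin 3) ℝ :=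
  (-(1 / 2 : ℝ)) • !![δ, 0, x 4;
                      0, δ, -x 3;
                      2 * x 3, 2 * x 4, 0]

/-- The vector `𝐦`. -/
def forceVector (δ : ℝ) (x : Fin 6 → ℝ) : Fin 3 → ℝ :=
  (1 / 2 : ℝ) • ![x 3 * x 2 ^ 2 - δ * x 2 * x 1,
                  x 4 * x 2 ^ 2 + δ * x 2 * x 0,
                  x 2 * (x 3 * x 0 + x 4 * x 1)]

/-- The vector `𝐯 = (v_x, v_y, v_φ)`. -/
def velocity (x : Fin 6 → ℝ) : Fin 3 → ℝ := ![x 0, x 1, x 2]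

/-- The reduced equations: `𝐯̇ = 𝕀⁻¹ 𝐦`, `𝐧̇ = 𝕁 𝐯` with `𝐧 = (N₁, N₂, M)`. -/
def reducedField (m I δ : ℝ) (x : Fin 6 → ℝ) : Fin 6 → ℝ :=
  Fin.append (m := 3) (n := 3) ((inertia m I δ x)⁻¹.mulVec (forceVector δ x))
    ((kinematicMatrix δ x).mulVec (velocity x))

/-- The inertia matrix is invertible on the phase space. -/
theorem inertia_det_pos {m I δ : ℝ} (hm : 0 < m) (hI : 0 < I) (hδ : 0 < δ) {x : Fin 6 → ℝ}
    (hx : x ∈ phaseSpace δ) : 0 < (inertia m I δ x).det := by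
  have hx' : x 3 ^ 2 + x 4 ^ 2 < δ * x 5 := hx
  have hM : 0 < x 5 := by
    by_contra h
    nlinarith [sq_nonneg (x 3), sq_nonneg (x 4), mul_nonneg hδ.le (neg_nonneg.2 (not_lt.1 h))]
  have h : (inertia m I δ x).det
      = (m + δ) * ((m + δ) * I + m * x 5 + (δ * x 5 - (x 3 ^ 2 + x 4 ^ 2))) := by
    rw [inertia, Matrix.det_fin_three]
    simp
    ring
  rw [h]
  have := mul_pos hm hM
  have := mul_pos (add_pos hm hδ) hI
  exact mul_pos (add_pos hm hδ) (by linarith)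

def f₁ (m δ : ℝ) (x : Fin 6 → ℝ) : ℝ := (m + δ) * x 0 - x 2 * x 4

def f₂ (m δ : ℝ) (x : Fin 6 → ℝ) : ℝ := (m + δ) * x 1 + x 2 * x 3

def f₃ (δ : ℝ) (x : Fin 6 → ℝ) : ℝ := δ * x 5 - (x 3 ^ 2 + x 4 ^ 2)

/-- The kinetic energy `T`. -/
def f₄ (m I δ : ℝ) (x : Fin 6 → ℝ) : ℝ :=
  1 / 2 * (I + x 5) * x 2 ^ 2 + 1 / 2 * (m + δ) * (x 0 ^ 2 + x 1 ^ 2)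
    + x 2 * (x 3 * x 1 - x 4 * x 0)

/-- The measure `√(det 𝕀) dv_x dv_y dv_φ dN₁ dN₂ dM` on the phase space. -/
def reducedMeasure (m I δ : ℝ) : Measure (Fin 6 → ℝ) :=
  (volume.restrict (phaseSpace δ)).withDensity
    (fun x => ENNReal.ofReal (Real.sqrt (inertia m I δ x).det))

end BallBearing

end

/-!
Write `a = m + δ`, `u = N₁² + N₂²` and `y = √(I + M - u / a)`, so that `√(det 𝕀) = a y`. Besides `f₁`
and `f₂`, the product `v_φ y` is constant along solutions: this is the energy integral with its sign
resolved, as `(v_φ y)² = 2 f₄ - (f₁² + f₂²) / a`. Rescaling these three constants to `η = (p, q, r)`,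
one can use `(p, q, r; N₁, N₂, y)` as coordinates on the phase space, and in the new time `s` with
`dt = y ds` the system becomes *linear* with constant coefficients: `z = (N₁, N₂, y)` satisfies
`dz/ds = L z`, where the matrix `L = L(η)` (`genMatrix`) has trace zero and satisfies `L³ = μ L`.
Hence `exp (s L) = 1 + S L + C L²` with two functions `S`, `C` of `μ` and `s`, entire in both
variables, and no case distinction is needed at `μ = 0`. The conserved form `y² - B u` is bounded
below by `I` on the phase space, so `t = ∫ y ds` is a global change of time (`innerTime`) and the
flow is complete and explicit (`flow`, `hasDerivAt_flow`); conversely every solution is given by it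
(`eq_flow_of_isSolutionOn`), because `exp (-σ L) z` is constant along a solution for `σ = ∫ dt / y`.

*Invariant measure.* For frozen `η` the time `T` map is `z ↦ exp (s(z) L) z`. Its differential is a
rank-one perturbation of `exp (s L)`, which has determinant one, and the perturbation has determinant
`y / y(T)` (`det_sliceFlowDeriv`). So `y dN₁ dN₂ dy` is preserved for each `η`, hence
`y dp dq dr dN₁ dN₂ dy` is preserved, and this is a constant multiple of `√(det 𝕀) dx`
(`coordMeasure_image`).

*Quadratures.* Near `s = 0` the function `S` inverts `∫ (1 + μ σ²)^(-1/2) dσ`, `C` is the integral of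
`S`, and `innerTime` inverts `∫ y ds`; both inverted functions have nonzero derivative at `0`. All
else is algebraic, so no point of the phase space, equilibrium or turning point, is exceptional.

*First integrals.* Their constancy is a direct differentiation. A `4 × 4` minor of their Jacobian
equals `δ v_φ det 𝕀` up to sign, so they are independent where `v_φ ≠ 0`.
-/

namespace BallBearing

open Matrix

/-! ### The coefficient functions of the exponential of a matrix with `L³ = μ L` -/

section Coefficients

attribute [local instance] Matrix.linftyOpNormedRing Matrix.linftyOpNormedAlgebra

/-- The companion-type matrix whose exponential has first row `(1, S, C, K)`, where `S' = 1 + μ C`,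
`C' = S`, `K' = C` and `S`, `C`, `K` vanish at `0`. -/
def companion (μ : ℝ) : Matrix (Fin 4) (Fin 4) ℝ :=
  !![0, 1, 0, 0; 0, 0, 1, 0; 0, μ, 0, 1; 0, 0, 0, 0]

/-- `S(μ, s) = ∑ μᵏ s²ᵏ⁺¹ / (2k+1)!`, that is, `sinh (√μ s) / √μ` for `μ > 0`. It is taken from a
matrix exponential, which makes it jointly continuous across `μ = 0` without any case split. -/
noncomputable def propS (μ s : ℝ) : ℝ := NormedSpace.exp (s • companion μ) 0 1

/-- `C(μ, s) = ∑ μᵏ s²ᵏ⁺² / (2k+2)!`, that is, `(cosh (√μ s) - 1) / μ` for `μ > 0`. -/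
noncomputable def propC (μ s : ℝ) : ℝ := NormedSpace.exp (s • companion μ) 0 2

/-- `K(μ, s) = ∑ μᵏ s²ᵏ⁺³ / (2k+3)!`, the primitive of `propC μ` that vanishes at `0`. -/
noncomputable def propK (μ s : ℝ) : ℝ := NormedSpace.exp (s • companion μ) 0 3

theorem hasDerivAt_exp_companion (μ s : ℝ) (j : Fin 4) :
    HasDerivAt (fun u : ℝ => NormedSpace.exp (u • companion μ) 0 j)
      ((NormedSpace.exp (s • companion μ) * companion μ) 0 j) s :=
  hasDerivAt_pi.1 (hasDerivAt_pi.1 (hasDerivAt_exp_smul_const (𝕂 := ℝ) (companion μ) s) 0) j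

theorem mul_companion (X : Matrix (Fin 4) (Fin 4) ℝ) (μ : ℝ) :
    (X * companion μ) 0 0 = 0 ∧ (X * companion μ) 0 1 = X 0 0 + X 0 2 * μ ∧
      (X * companion μ) 0 2 = X 0 1 ∧ (X * companion μ) 0 3 = X 0 2 := by
  simp [Matrix.mul_apply, Fin.sum_univ_four, companion]

theorem exp_companion_zero_zero (μ s : ℝ) :
    NormedSpace.exp (s • companion μ) 0 0 = 1 := by
  have h : ∀ u, HasDerivAt (fun u : ℝ => NormedSpace.exp (u • companion μ) 0 0) 0 u := fun u =>
    (hasDerivAt_exp_companion μ u 0).congr_deriv (mul_companion _ μ).1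
  rw [is_const_of_deriv_eq_zero (fun u => (h u).differentiableAt) (fun u => (h u).deriv) s 0]
  simp

theorem continuous_exp_companion (j : Fin 4) :
    Continuous fun p : ℝ × ℝ => NormedSpace.exp (p.2 • companion p.1) 0 j := by
  have hc : Continuous companion := by
    refine continuous_matrix fun i j => ?_
    fin_cases i <;> fin_cases j <;> simp [companion] <;> fun_prop
  have : Continuous fun p : ℝ × ℝ => NormedSpace.exp (p.2 • companion p.1) :=
    NormedSpace.exp_continuous.comp (continuous_snd.smul (hc.comp continuous_fst))
  exact (continuous_apply_apply (0 : Fin 4) j).comp this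

@[fun_prop] theorem continuous_propS : Continuous fun p : ℝ × ℝ => propS p.1 p.2 :=
  continuous_exp_companion 1

@[fun_prop] theorem continuous_propC : Continuous fun p : ℝ × ℝ => propC p.1 p.2 :=
  continuous_exp_companion 2

@[fun_prop] theorem continuous_propK : Continuous fun p : ℝ × ℝ => propK p.1 p.2 :=
  continuous_exp_companion 3

@[simp] theorem propS_zero (μ : ℝ) : propS μ 0 = 0 := by simp [propS]

@[simp] theorem propC_zero (μ : ℝ) : propC μ 0 = 0 := by simp [propC]

@[simp] theorem propK_zero (μ : ℝ) : propK μ 0 = 0 := by simp [propK]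

theorem hasDerivAt_propS (μ s : ℝ) : HasDerivAt (propS μ) (1 + μ * propC μ s) s := by
  refine (hasDerivAt_exp_companion μ s 1).congr_deriv ?_
  rw [(mul_companion _ μ).2.1, exp_companion_zero_zero, mul_comm μ]
  rfl

theorem hasDerivAt_propC (μ s : ℝ) : HasDerivAt (propC μ) (propS μ s) s :=
  (hasDerivAt_exp_companion μ s 2).congr_deriv (mul_companion _ μ).2.2.1

theorem hasDerivAt_propK (μ s : ℝ) : HasDerivAt (propK μ) (propC μ s) s :=
  (hasDerivAt_exp_companion μ s 3).congr_deriv (mul_companion _ μ).2.2.2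

end Coefficients

/-- `cosh² - 1 = sinh²`, divided by `μ`. -/
theorem propS_sq (μ s : ℝ) : propS μ s ^ 2 = 2 * propC μ s + μ * propC μ s ^ 2 := by
  have h : ∀ u, HasDerivAt (fun u => propS μ u ^ 2 - (2 * propC μ u + μ * propC μ u ^ 2)) 0 u :=
    fun u => by
      have hS := hasDerivAt_propS μ u
      have hC := hasDerivAt_propC μ u
      refine ((hS.pow 2).sub ((hC.const_mul 2).add ((hC.pow 2).const_mul μ))).congr_deriv ?_
      ring
  have := is_const_of_deriv_eq_zero (fun u => (h u).differentiableAt) (fun u => (h u).deriv) s 0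
  simp at this
  linarith

theorem propS_eq (μ s : ℝ) : propS μ s = s + μ * propK μ s := by
  have h : ∀ u, HasDerivAt (fun u => propS μ u - (u + μ * propK μ u)) 0 u := fun u => by
    refine ((hasDerivAt_propS μ u).sub
      ((hasDerivAt_id u).add ((hasDerivAt_propK μ u).const_mul μ))).congr_deriv ?_
    ring
  have := is_const_of_deriv_eq_zero (fun u => (h u).differentiableAt) (fun u => (h u).deriv) s 0
  simp at this
  linarith

theorem one_add_mul_propC_sq (μ s : ℝ) : (1 + μ * propC μ s) ^ 2 = 1 + μ * propS μ s ^ 2 := by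
  rw [propS_sq]; ring

/-! ### The linear system with constant coefficients -/

/-- The matrix `L` of the linear system in the variables `(N₁, N₂, y)` and the new time `s`, for
frozen parameters `η = (p, q, r)`. -/
def genMatrix (B : ℝ) (η : Fin 3 → ℝ) : Matrix (Fin 3) (Fin 3) ℝ :=
  !![0, -η 2, -η 0; η 2, 0, -η 1; -(B * η 0), -(B * η 1), 0]

/-- The number `μ` with `L³ = μ L`. -/
def genDisc (B : ℝ) (η : Fin 3 → ℝ) : ℝ := B * (η 0 ^ 2 + η 1 ^ 2) - η 2 ^ 2

theorem genMatrix_cube (B : ℝ) (η : Fin 3 → ℝ) :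
    genMatrix B η * (genMatrix B η * genMatrix B η) = genDisc B η • genMatrix B η := by
  ext i j
  fin_cases i <;> fin_cases j <;>
    simp [genMatrix, genDisc, Matrix.mul_apply, Fin.sum_univ_three] <;> ring

/-- The exponential `exp (s L) = 1 + S L + C L²`. -/
noncomputable def propagator (B : ℝ) (η : Fin 3 → ℝ) (s : ℝ) : Matrix (Fin 3) (Fin 3) ℝ :=
  1 + propS (genDisc B η) s • genMatrix B η
    + propC (genDisc B η) s • (genMatrix B η * genMatrix B η)

/-- The inverse exponential `exp (-s L) = 1 - S L + C L²`. -/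
noncomputable def propagatorInv (B : ℝ) (η : Fin 3 → ℝ) (s : ℝ) : Matrix (Fin 3) (Fin 3) ℝ :=
  1 - propS (genDisc B η) s • genMatrix B η
    + propC (genDisc B η) s • (genMatrix B η * genMatrix B η)

/-- The integral `∫₀ˢ exp (σ L) dσ = s + C L + K L²`. -/
noncomputable def propagatorInt (B : ℝ) (η : Fin 3 → ℝ) (s : ℝ) : Matrix (Fin 3) (Fin 3) ℝ :=
  s • (1 : Matrix (Fin 3) (Fin 3) ℝ) + propC (genDisc B η) s • genMatrix B η
    + propK (genDisc B η) s • (genMatrix B η * genMatrix B η)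

@[simp] theorem propagator_zero (B : ℝ) (η : Fin 3 → ℝ) : propagator B η 0 = 1 := by
  simp [propagator]

@[simp] theorem propagatorInv_zero (B : ℝ) (η : Fin 3 → ℝ) : propagatorInv B η 0 = 1 := by
  simp [propagatorInv]

@[simp] theorem propagatorInt_zero (B : ℝ) (η : Fin 3 → ℝ) : propagatorInt B η 0 = 0 := by
  simp [propagatorInt]

theorem propagator_mul_inv (B : ℝ) (η : Fin 3 → ℝ) (s : ℝ) :
    propagator B η s * propagatorInv B η s = 1 := by
  have h3 := genMatrix_cube B η
  have hS := propS_sq (genDisc B η) s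
  unfold propagator propagatorInv
  generalize genMatrix B η = L at *
  generalize propS (genDisc B η) s = S at *
  generalize propC (genDisc B η) s = C at *
  generalize genDisc B η = μ at *
  have h3' : L * L * L = μ • L := by rw [Matrix.mul_assoc, h3]
  have h4 : L * L * (L * L) = μ • (L * L) := by rw [← Matrix.mul_assoc, h3', smul_mul_assoc]
  simp only [mul_add, add_mul, mul_sub, smul_mul_assoc, mul_smul_comm, h3, h3', h4, mul_one,
    one_mul]
  match_scalars
  all_goals first | ring1 | linear_combination -hS

theorem propagatorInt_mul_gen (B : ℝ) (η : Fin 3 → ℝ) (s : ℝ) :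
    propagatorInt B η s * genMatrix B η = propagator B η s - 1 := by
  have h3 := genMatrix_cube B η
  have hS := propS_eq (genDisc B η) s
  unfold propagator propagatorInt
  rw [hS]
  simp only [add_mul, smul_mul_assoc, Matrix.mul_assoc, h3, one_mul]
  module

theorem gen_mul_propagator (B : ℝ) (η : Fin 3 → ℝ) (s : ℝ) :
    genMatrix B η * propagator B η s
      = (1 + genDisc B η * propC (genDisc B η) s) • genMatrix B η
        + propS (genDisc B η) s • (genMatrix B η * genMatrix B η) := by
  have h3 := genMatrix_cube B η
  unfold propagator
  simp only [mul_add, mul_smul_comm, h3, mul_one]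
  module

theorem commute_gen_propagator (B : ℝ) (η : Fin 3 → ℝ) (s : ℝ) :
    Commute (genMatrix B η) (propagator B η s) := by
  unfold propagator
  exact ((Commute.one_right _).add_right ((Commute.refl _).smul_right _)).add_right
    (((Commute.refl _).mul_right (Commute.refl _)).smul_right _)

/-- Liouville's formula: `L` has trace zero. -/
theorem det_propagator (B : ℝ) (η : Fin 3 → ℝ) (s : ℝ) : (propagator B η s).det = 1 := by
  have h := propS_sq (genDisc B η) s
  have : (propagator B η s).det = (1 + genDisc B η * propC (genDisc B η) s) ^ 2
      - genDisc B η * propS (genDisc B η) s ^ 2 := by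
    rw [propagator, Matrix.det_fin_three]
    generalize propS (genDisc B η) s = S at *
    generalize propC (genDisc B η) s = C at *
    simp [genMatrix, genDisc]
    ring
  rw [this, one_add_mul_propC_sq]
  ring

theorem propagator_mulVec (B : ℝ) (η : Fin 3 → ℝ) (s : ℝ) (z : Fin 3 → ℝ) :
    propagator B η s *ᵥ z = z + propS (genDisc B η) s • (genMatrix B η *ᵥ z)
      + propC (genDisc B η) s • ((genMatrix B η * genMatrix B η) *ᵥ z) := by
  simp [propagator, Matrix.add_mulVec, Matrix.smul_mulVec]

theorem propagatorInv_mulVec (B : ℝ) (η : Fin 3 → ℝ) (s : ℝ) (z : Fin 3 → ℝ) :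
    propagatorInv B η s *ᵥ z = z - propS (genDisc B η) s • (genMatrix B η *ᵥ z)
      + propC (genDisc B η) s • ((genMatrix B η * genMatrix B η) *ᵥ z) := by
  simp [propagatorInv, Matrix.add_mulVec, Matrix.sub_mulVec, Matrix.smul_mulVec]

theorem propagatorInt_mulVec (B : ℝ) (η : Fin 3 → ℝ) (s : ℝ) (z : Fin 3 → ℝ) :
    propagatorInt B η s *ᵥ z = s • z + propC (genDisc B η) s • (genMatrix B η *ᵥ z)
      + propK (genDisc B η) s • ((genMatrix B η * genMatrix B η) *ᵥ z) := by
  simp [propagatorInt, Matrix.add_mulVec, Matrix.smul_mulVec]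

theorem hasDerivAt_propagator (B : ℝ) (η : Fin 3 → ℝ) (z : Fin 3 → ℝ) (s : ℝ) :
    HasDerivAt (fun s => propagator B η s *ᵥ z) (genMatrix B η *ᵥ (propagator B η s *ᵥ z)) s := by
  rw [Matrix.mulVec_mulVec, gen_mul_propagator, Matrix.add_mulVec, Matrix.smul_mulVec,
    Matrix.smul_mulVec]
  simp only [propagator_mulVec]
  exact (((hasDerivAt_propS (genDisc B η) s).smul_const _).const_add z).add
    ((hasDerivAt_propC (genDisc B η) s).smul_const _)

theorem hasDerivAt_propagatorInt (B : ℝ) (η : Fin 3 → ℝ) (z : Fin 3 → ℝ) (s : ℝ) :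
    HasDerivAt (fun s => propagatorInt B η s *ᵥ z) (propagator B η s *ᵥ z) s := by
  simp only [propagator_mulVec, propagatorInt_mulVec]
  refine HasDerivAt.add (HasDerivAt.add ?_ ((hasDerivAt_propC (genDisc B η) s).smul_const _))
    ((hasDerivAt_propK (genDisc B η) s).smul_const _)
  simpa using (hasDerivAt_id s).smul_const z

/-- Along a curve that solves the system up to a change of time, `exp (-σ L) γ` is constant. -/
theorem hasDerivWithinAt_propagatorInv {B : ℝ} {η : Fin 3 → ℝ} {γ : ℝ → Fin 3 → ℝ} {σ : ℝ → ℝ}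
    {J : Set ℝ} {t k : ℝ} (hσ : HasDerivWithinAt σ k J t)
    (hγ : HasDerivWithinAt γ (k • (genMatrix B η *ᵥ γ t)) J t) :
    HasDerivWithinAt (fun t => propagatorInv B η (σ t) *ᵥ γ t) 0 J t := by
  have hlin : ∀ A : Matrix (Fin 3) (Fin 3) ℝ,
      HasDerivWithinAt (fun t => A *ᵥ γ t) (A *ᵥ (k • (genMatrix B η *ᵥ γ t))) J t := fun A =>
    (LinearMap.toContinuousLinearMap A.mulVecLin).hasFDerivAt.comp_hasDerivWithinAt t hγ
  have hS := (hasDerivAt_propS (genDisc B η) (σ t)).comp_hasDerivWithinAt t hσ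
  have hC := (hasDerivAt_propC (genDisc B η) (σ t)).comp_hasDerivWithinAt t hσ
  have h3 : genMatrix B η *ᵥ (genMatrix B η *ᵥ (genMatrix B η *ᵥ γ t))
      = genDisc B η • (genMatrix B η *ᵥ γ t) := by
    simp only [Matrix.mulVec_mulVec, ← Matrix.smul_mulVec]
    rw [← genMatrix_cube]
  simp only [propagatorInv_mulVec]
  refine ((hγ.sub (hS.smul (hlin _))).add (hC.smul (hlin _))).congr_deriv ?_
  simp only [← Matrix.mulVec_mulVec, Matrix.mulVec_smul, h3, Function.comp]
  module

/-! ### The region of admissible `(N₁, N₂, y)` and the change of time -/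

/-- The region to which the phase space corresponds in the coordinates `(N₁, N₂, y)`. -/
def region (I₀ B : ℝ) : Set (Fin 3 → ℝ) :=
  {z | 0 < z 2 ∧ I₀ + B * (z 0 ^ 2 + z 1 ^ 2) < z 2 ^ 2}

theorem isOpen_region (I₀ B : ℝ) : IsOpen (region I₀ B) :=
  (isOpen_lt (f := fun _ : Fin 3 → ℝ => (0 : ℝ)) (g := fun z => z 2)
    (by fun_prop) (by fun_prop)).inter
    (isOpen_lt (f := fun z : Fin 3 → ℝ => I₀ + B * (z 0 ^ 2 + z 1 ^ 2)) (g := fun z => z 2 ^ 2)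
      (by fun_prop) (by fun_prop))

/-- The quadratic form `y² - B (N₁² + N₂²)` is invariant under `exp (s L)`. -/
theorem propagator_quadratic (B : ℝ) (η z : Fin 3 → ℝ) (s : ℝ) :
    (propagator B η s *ᵥ z) 2 ^ 2
        - B * ((propagator B η s *ᵥ z) 0 ^ 2 + (propagator B η s *ᵥ z) 1 ^ 2)
      = z 2 ^ 2 - B * (z 0 ^ 2 + z 1 ^ 2) := by
  have h : ∀ u, HasDerivAt (fun u => (propagator B η u *ᵥ z) 2 ^ 2
      - B * ((propagator B η u *ᵥ z) 0 ^ 2 + (propagator B η u *ᵥ z) 1 ^ 2)) 0 u := fun u => by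
    have hp := hasDerivAt_pi.1 (hasDerivAt_propagator B η z u)
    refine (((hp 2).pow 2).sub ((((hp 0).pow 2).add ((hp 1).pow 2)).const_mul B)).congr_deriv ?_
    generalize propagator B η u *ᵥ z = w
    simp [genMatrix, Matrix.mulVec, dotProduct, Fin.sum_univ_three]
    ring
  have := is_const_of_deriv_eq_zero (fun u => (h u).differentiableAt) (fun u => (h u).deriv) s 0
  simpa using this

theorem propagator_sq_gt {I₀ B : ℝ} {z : Fin 3 → ℝ} (hz : z ∈ region I₀ B) (η : Fin 3 → ℝ)
    (s : ℝ) : I₀ + B * ((propagator B η s *ᵥ z) 0 ^ 2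
      + (propagator B η s *ᵥ z) 1 ^ 2) < (propagator B η s *ᵥ z) 2 ^ 2 := by
  have := propagator_quadratic B η z s
  have := hz.2
  linarith

theorem propagator_mem_region {I₀ B : ℝ} (hI : 0 < I₀) (hB : 0 < B) {z : Fin 3 → ℝ}
    (hz : z ∈ region I₀ B) (η : Fin 3 → ℝ) (s : ℝ) : propagator B η s *ᵥ z ∈ region I₀ B := by
  refine ⟨?_, propagator_sq_gt hz η s⟩
  -- the last coordinate never vanishes, so it keeps its sign
  by_contra! hs
  have hc : Continuous fun s => (propagator B η s *ᵥ z) 2 :=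
    continuous_iff_continuousAt.2 fun u =>
      (hasDerivAt_pi.1 (hasDerivAt_propagator B η z u) 2).continuousAt
  have h0 : (0 : ℝ) ≤ (propagator B η 0 *ᵥ z) 2 := by simpa using hz.1.le
  obtain ⟨u, hu⟩ := mem_range_of_exists_le_of_exists_ge hc ⟨s, hs⟩ ⟨0, h0⟩
  have h := propagator_sq_gt hz η u
  simp only at hu
  rw [hu] at h
  nlinarith [sq_nonneg ((propagator B η u *ᵥ z) 0), sq_nonneg ((propagator B η u *ᵥ z) 1)]

theorem sqrt_le_of_mem_region {I₀ B : ℝ} (hB : 0 < B) {z : Fin 3 → ℝ} (hz : z ∈ region I₀ B) :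
    √I₀ ≤ z 2 := by
  apply Real.sqrt_le_iff.2 ⟨hz.1.le, ?_⟩
  nlinarith [sq_nonneg (z 0), sq_nonneg (z 1), hz.2]

/-- The physical time `t = ∫₀ˢ y dσ` that elapses while the new time runs from `0` to `s`. -/
noncomputable def elapsed (B : ℝ) (η z : Fin 3 → ℝ) (s : ℝ) : ℝ := (propagatorInt B η s *ᵥ z) 2

@[simp] theorem elapsed_zero (B : ℝ) (η z : Fin 3 → ℝ) : elapsed B η z 0 = 0 := by
  simp [elapsed]

theorem hasDerivAt_elapsed (B : ℝ) (η z : Fin 3 → ℝ) (s : ℝ) :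
    HasDerivAt (elapsed B η z) ((propagator B η s *ᵥ z) 2) s :=
  hasDerivAt_pi.1 (hasDerivAt_propagatorInt B η z s) 2

theorem continuous_elapsed (B : ℝ) (η z : Fin 3 → ℝ) : Continuous (elapsed B η z) :=
  continuous_iff_continuousAt.2 fun u => (hasDerivAt_elapsed B η z u).continuousAt

/-- The speed of the change of time is at least `√I₀`, which makes it a bijection of `ℝ`. -/
theorem mul_sub_le_elapsed_sub {I₀ B : ℝ} (hI : 0 < I₀) (hB : 0 < B) {z : Fin 3 → ℝ}
    (hz : z ∈ region I₀ B) (η : Fin 3 → ℝ) {s₁ s₂ : ℝ} (h : s₁ ≤ s₂) :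
    √I₀ * (s₂ - s₁) ≤ elapsed B η z s₂ - elapsed B η z s₁ := by
  refine mul_sub_le_image_sub_of_le_deriv
    (fun s => (hasDerivAt_elapsed B η z s).differentiableAt) (fun s => ?_) h
  rw [(hasDerivAt_elapsed B η z s).deriv]
  exact sqrt_le_of_mem_region hB (propagator_mem_region hI hB hz η s)

theorem mul_abs_sub_le_elapsed_sub {I₀ B : ℝ} (hI : 0 < I₀) (hB : 0 < B) {z : Fin 3 → ℝ}
    (hz : z ∈ region I₀ B) (η : Fin 3 → ℝ) (s₁ s₂ : ℝ) :
    √I₀ * |s₂ - s₁| ≤ |elapsed B η z s₂ - elapsed B η z s₁| := by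
  rcases le_total s₁ s₂ with h | h
  · rw [abs_of_nonneg (sub_nonneg.2 h)]
    exact (mul_sub_le_elapsed_sub hI hB hz η h).trans (le_abs_self _)
  · rw [abs_sub_comm, abs_of_nonneg (sub_nonneg.2 h), abs_sub_comm]
    exact (mul_sub_le_elapsed_sub hI hB hz η h).trans (le_abs_self _)

theorem strictMono_elapsed {I₀ B : ℝ} (hI : 0 < I₀) (hB : 0 < B) {z : Fin 3 → ℝ}
    (hz : z ∈ region I₀ B) (η : Fin 3 → ℝ) : StrictMono (elapsed B η z) := fun s₁ s₂ h => by
  have := mul_sub_le_elapsed_sub hI hB hz η h.le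
  have : 0 < √I₀ * (s₂ - s₁) := mul_pos (Real.sqrt_pos.2 hI) (sub_pos.2 h)
  linarith

theorem surjective_elapsed {I₀ B : ℝ} (hI : 0 < I₀) (hB : 0 < B) {z : Fin 3 → ℝ}
    (hz : z ∈ region I₀ B) (η : Fin 3 → ℝ) : Function.Surjective (elapsed B η z) := by
  have hpos := Real.sqrt_pos.2 hI
  apply (continuous_elapsed B η z).surjective
  · apply tendsto_atTop_mono' atTop _ (tendsto_id.const_mul_atTop hpos)
    filter_upwards [eventually_ge_atTop 0] with s hs
    simpa using mul_sub_le_elapsed_sub hI hB hz η hs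
  · apply tendsto_atBot_mono' atBot _ (tendsto_id.const_mul_atBot hpos)
    filter_upwards [eventually_le_atBot 0] with s hs
    have := mul_sub_le_elapsed_sub hI hB hz η hs
    simp at this
    simpa using this

open Classical in
/-- The new time `s` at which the physical time `T` has elapsed; it is set to `0` outside the
region. -/
noncomputable def innerTime (I₀ B T : ℝ) (η z : Fin 3 → ℝ) : ℝ :=
  if z ∈ region I₀ B then Function.invFun (elapsed B η z) T else 0

theorem elapsed_innerTime {I₀ B : ℝ} (hI : 0 < I₀) (hB : 0 < B) {z : Fin 3 → ℝ}
    (hz : z ∈ region I₀ B) (T : ℝ) (η : Fin 3 → ℝ) :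
    elapsed B η z (innerTime I₀ B T η z) = T := by
  rw [innerTime, if_pos hz]
  exact Function.invFun_eq (surjective_elapsed hI hB hz η T)

theorem innerTime_eq {I₀ B : ℝ} (hI : 0 < I₀) (hB : 0 < B) {z : Fin 3 → ℝ}
    (hz : z ∈ region I₀ B) {T s : ℝ} {η : Fin 3 → ℝ} (h : elapsed B η z s = T) :
    innerTime I₀ B T η z = s :=
  (strictMono_elapsed hI hB hz η).injective ((elapsed_innerTime hI hB hz T η).trans h.symm)

theorem innerTime_zero {I₀ B : ℝ} (hI : 0 < I₀) (hB : 0 < B) {z : Fin 3 → ℝ}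
    (hz : z ∈ region I₀ B) (η : Fin 3 → ℝ) : innerTime I₀ B 0 η z = 0 :=
  innerTime_eq hI hB hz (elapsed_zero B η z)

theorem abs_innerTime_sub_le {I₀ B : ℝ} (hI : 0 < I₀) (hB : 0 < B) {z : Fin 3 → ℝ}
    (hz : z ∈ region I₀ B) (T : ℝ) (η : Fin 3 → ℝ) (s : ℝ) :
    |innerTime I₀ B T η z - s| ≤ |T - elapsed B η z s| / √I₀ := by
  rw [le_div_iff₀ (Real.sqrt_pos.2 hI), mul_comm]
  simpa [elapsed_innerTime hI hB hz] using
    mul_abs_sub_le_elapsed_sub hI hB hz η s (innerTime I₀ B T η z)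

theorem continuous_innerTime {I₀ B : ℝ} (hI : 0 < I₀) (hB : 0 < B) {z : Fin 3 → ℝ}
    (hz : z ∈ region I₀ B) (η : Fin 3 → ℝ) : Continuous fun t => innerTime I₀ B t η z := by
  refine continuous_iff_continuousAt.2 fun t => ?_
  rw [ContinuousAt, tendsto_iff_dist_tendsto_zero]
  refine squeeze_zero (fun _ => dist_nonneg)
    (fun u => abs_innerTime_sub_le hI hB hz u η (innerTime I₀ B t η z)) ?_
  have : Continuous fun u : ℝ => |u - elapsed B η z (innerTime I₀ B t η z)| / √I₀ := by fun_prop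
  simpa [elapsed_innerTime hI hB hz] using this.tendsto t

theorem hasDerivAt_innerTime {I₀ B : ℝ} (hI : 0 < I₀) (hB : 0 < B) {z : Fin 3 → ℝ}
    (hz : z ∈ region I₀ B) (t : ℝ) (η : Fin 3 → ℝ) :
    HasDerivAt (fun t => innerTime I₀ B t η z)
      ((propagator B η (innerTime I₀ B t η z) *ᵥ z) 2)⁻¹ t :=
  HasDerivAt.of_local_left_inverse (continuous_innerTime hI hB hz η).continuousAt
    (hasDerivAt_elapsed B η z _) (propagator_mem_region hI hB hz η _).1.ne'
    (Eventually.of_forall fun u => elapsed_innerTime hI hB hz u η)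

/-! ### The flow for frozen parameters -/

/-- The flow of `ż = y⁻¹ L z` on the region, `y` being the last coordinate of `z`. -/
noncomputable def sliceFlow (I₀ B T : ℝ) (η z : Fin 3 → ℝ) : Fin 3 → ℝ :=
  propagator B η (innerTime I₀ B T η z) *ᵥ z

theorem sliceFlow_mem_region {I₀ B : ℝ} (hI : 0 < I₀) (hB : 0 < B) {z : Fin 3 → ℝ}
    (hz : z ∈ region I₀ B) (T : ℝ) (η : Fin 3 → ℝ) : sliceFlow I₀ B T η z ∈ region I₀ B :=
  propagator_mem_region hI hB hz η _

theorem sliceFlow_zero {I₀ B : ℝ} (hI : 0 < I₀) (hB : 0 < B) {z : Fin 3 → ℝ}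
    (hz : z ∈ region I₀ B) (η : Fin 3 → ℝ) : sliceFlow I₀ B 0 η z = z := by
  simp [sliceFlow, innerTime_zero hI hB hz]

theorem hasDerivAt_sliceFlow {I₀ B : ℝ} (hI : 0 < I₀) (hB : 0 < B) {z : Fin 3 → ℝ}
    (hz : z ∈ region I₀ B) (t : ℝ) (η : Fin 3 → ℝ) :
    HasDerivAt (fun t => sliceFlow I₀ B t η z)
      ((sliceFlow I₀ B t η z 2)⁻¹ • (genMatrix B η *ᵥ sliceFlow I₀ B t η z)) t :=
  HasDerivAt.scomp t (hasDerivAt_propagator B η z _) (hasDerivAt_innerTime hI hB hz t η)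

/-- Uniqueness of solutions: the inverse propagator, run with the new time `∫ y⁻¹ dt`, maps a
solution to a constant. -/
theorem eq_sliceFlow {I₀ B : ℝ} (hI : 0 < I₀) (hB : 0 < B) {η : Fin 3 → ℝ} {T : ℝ}
    {γ : ℝ → Fin 3 → ℝ} (hmem : ∀ t ∈ uIcc 0 T, γ t ∈ region I₀ B)
    (hγ : ∀ t ∈ uIcc 0 T,
      HasDerivWithinAt γ ((γ t 2)⁻¹ • (genMatrix B η *ᵥ γ t)) (uIcc 0 T) t) :
    γ T = sliceFlow I₀ B T η (γ 0) := by
  have hle : min 0 T ≤ max 0 T := min_le_max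
  have h0 : (0 : ℝ) ∈ uIcc 0 T := left_mem_uIcc
  have hT : T ∈ uIcc 0 T := right_mem_uIcc
  have hcont : ContinuousOn (fun t => (γ t 2)⁻¹) (Icc (min 0 T) (max 0 T)) := fun t ht =>
    ((hasDerivWithinAt_pi.1 (hγ t ht) 2).continuousWithinAt).inv₀ (hmem t ht).1.ne'
  -- `h` extends `1 / y` continuously to all times, which makes `σ` differentiable everywhere
  set h : ℝ → ℝ := IccExtend hle ((Icc (min 0 T) (max 0 T)).domRestrict fun t => (γ t 2)⁻¹)
  have hh : Continuous h := hcont.domRestrict.Icc_extend'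
  have hval : ∀ t ∈ uIcc 0 T, h t = (γ t 2)⁻¹ := fun t ht => by
    simp only [h]
    rw [IccExtend_of_mem hle _ ht]
    rfl
  set σ : ℝ → ℝ := fun t => ∫ u in (0 : ℝ)..t, h u
  have hσ : ∀ t ∈ uIcc 0 T, HasDerivWithinAt σ (γ t 2)⁻¹ (uIcc 0 T) t := fun t ht => by
    rw [← hval t ht]
    exact (hh.integral_hasStrictDerivAt 0 t).hasDerivAt.hasDerivWithinAt
  have hσ0 : σ 0 = 0 := by simp [σ]
  have hconst : ∀ {E : Type} [NormedAddCommGroup E] [NormedSpace ℝ E] (f : ℝ → E),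
      (∀ t ∈ uIcc 0 T, HasDerivWithinAt f 0 (uIcc 0 T) t) → ∀ t ∈ uIcc 0 T, f t = f 0 := by
    intro E _ _ f hf t ht
    have := (convex_uIcc (0 : ℝ) T).norm_image_sub_le_of_norm_hasDerivWithin_le (C := 0) hf
      (fun _ _ => by simp) h0 ht
    simpa [sub_eq_zero] using this
  have hsol : ∀ t ∈ uIcc 0 T, γ t = propagator B η (σ t) *ᵥ γ 0 := fun t ht => by
    have h1 := hconst _ (fun u hu => hasDerivWithinAt_propagatorInv (hσ u hu) (hγ u hu)) t ht
    simp only [hσ0, propagatorInv_zero, Matrix.one_mulVec] at h1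
    rw [← h1, Matrix.mulVec_mulVec, propagator_mul_inv, Matrix.one_mulVec]
  have htime : elapsed B η (γ 0) (σ T) = T := by
    have h1 := hconst (fun t => elapsed B η (γ 0) (σ t) - t) (fun t ht => by
      have h2 := (hasDerivAt_elapsed B η (γ 0) (σ t)).comp_hasDerivWithinAt t (hσ t ht)
      refine (h2.sub (hasDerivWithinAt_id t _)).congr_deriv ?_
      rw [← hsol t ht, mul_inv_cancel₀ (hmem t ht).1.ne', sub_self]) T hT
    simpa [hσ0, sub_eq_zero] using h1
  rw [hsol T hT, sliceFlow, innerTime_eq hI hB (hmem 0 h0) htime]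

theorem sliceFlow_neg {I₀ B : ℝ} (hI : 0 < I₀) (hB : 0 < B) {z : Fin 3 → ℝ}
    (hz : z ∈ region I₀ B) (T : ℝ) (η : Fin 3 → ℝ) :
    sliceFlow I₀ B (-T) η (sliceFlow I₀ B T η z) = z := by
  have := eq_sliceFlow hI hB (T := -T) (γ := fun t => sliceFlow I₀ B (T + t) η z) (η := η)
    (fun t _ => sliceFlow_mem_region hI hB hz _ η)
    (fun t _ => ((hasDerivAt_sliceFlow hI hB hz (T + t) η).comp_const_add T t).hasDerivWithinAt)
  simp only [add_neg_cancel, add_zero, sliceFlow_zero hI hB hz] at this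
  exact this.symm

theorem bijOn_sliceFlow {I₀ B : ℝ} (hI : 0 < I₀) (hB : 0 < B) (T : ℝ) (η : Fin 3 → ℝ) :
    BijOn (sliceFlow I₀ B T η) (region I₀ B) (region I₀ B) := by
  refine BijOn.mk (fun z hz => sliceFlow_mem_region hI hB hz T η) (fun z hz w hw h => ?_)
    fun z hz => ⟨_, sliceFlow_mem_region hI hB hz (-T) η, ?_⟩
  · rw [← sliceFlow_neg hI hB hz T η, h, sliceFlow_neg hI hB hw T η]
  · simpa using sliceFlow_neg hI hB hz (-T) η

/-! ### The measure `y dN₁ dN₂ dy` is invariant for frozen parameters -/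

theorem continuous_genMatrix (B : ℝ) : Continuous (genMatrix B) := by
  refine continuous_matrix fun i j => ?_
  fin_cases i <;> fin_cases j <;> simp [genMatrix] <;> fun_prop

theorem continuous_genDisc (B : ℝ) : Continuous (genDisc B) := by
  unfold genDisc; fun_prop

theorem continuous_elapsed_param (B s : ℝ) :
    Continuous fun p : (Fin 3 → ℝ) × (Fin 3 → ℝ) => elapsed B p.1 p.2 s := by
  have hL := continuous_genMatrix B
  have hd := continuous_genDisc B
  simp only [elapsed, propagatorInt]
  refine (continuous_apply (2 : Fin 3)).comp (Continuous.matrix_mulVec ?_ continuous_snd)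
  have hC : Continuous fun p : (Fin 3 → ℝ) × (Fin 3 → ℝ) => propC (genDisc B p.1) s :=
    continuous_propC.comp ((hd.comp continuous_fst).prodMk continuous_const)
  have hK : Continuous fun p : (Fin 3 → ℝ) × (Fin 3 → ℝ) => propK (genDisc B p.1) s :=
    continuous_propK.comp ((hd.comp continuous_fst).prodMk continuous_const)
  have hL' := hL.comp (continuous_fst (X := Fin 3 → ℝ) (Y := Fin 3 → ℝ))
  exact (continuous_const.add (hC.smul hL')).add (hK.smul (hL'.matrix_mul hL'))

theorem measurable_innerTime {I₀ B : ℝ} (hI : 0 < I₀) (hB : 0 < B) (T : ℝ) :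
    Measurable fun p : (Fin 3 → ℝ) × (Fin 3 → ℝ) => innerTime I₀ B T p.1 p.2 := by
  refine measurable_of_Iic fun r => ?_
  -- on the region, `innerTime ≤ r` if and only if the time elapsed at `r` is at least `T`
  have hset : (fun p : (Fin 3 → ℝ) × (Fin 3 → ℝ) => innerTime I₀ B T p.1 p.2) ⁻¹' Iic r
      = (Prod.snd ⁻¹' region I₀ B ∩ {p | T ≤ elapsed B p.1 p.2 r}) ∪
        (Prod.snd ⁻¹' (region I₀ B)ᶜ ∩ {_p | 0 ≤ r}) := by
    ext ⟨η, z⟩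
    by_cases hz : z ∈ region I₀ B
    · have := (strictMono_elapsed hI hB hz η).le_iff_le (a := innerTime I₀ B T η z) (b := r)
      rw [elapsed_innerTime hI hB hz] at this
      simp [hz, this]
    · simp [hz, innerTime]
  rw [hset]
  have hR := (isOpen_region I₀ B).measurableSet
  exact ((measurable_snd hR).inter
    (measurableSet_le measurable_const (continuous_elapsed_param B r).measurable)).union
    ((measurable_snd hR.compl).inter (MeasurableSet.const _))

theorem measurable_sliceFlow {I₀ B : ℝ} (hI : 0 < I₀) (hB : 0 < B) (T : ℝ) :
    Measurable fun p : (Fin 3 → ℝ) × (Fin 3 → ℝ) => sliceFlow I₀ B T p.1 p.2 := by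
  have hL := (continuous_genMatrix B).comp (continuous_fst (X := Fin 3 → ℝ) (Y := Fin 3 → ℝ))
  have hd := (continuous_genDisc B).comp (continuous_fst (X := Fin 3 → ℝ) (Y := Fin 3 → ℝ))
  have hs := measurable_innerTime hI hB T
  simp only [sliceFlow, propagator_mulVec]
  have h1 := (hL.matrix_mulVec continuous_snd).measurable
  have h2 := ((hL.matrix_mul hL).matrix_mulVec continuous_snd).measurable
  have hS := continuous_propS.measurable.comp (hd.measurable.prodMk hs)
  have hC := continuous_propC.measurable.comp (hd.measurable.prodMk hs)
  exact (measurable_snd.add (hS.smul h1)).add (hC.smul h2)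

theorem continuousAt_innerTime {I₀ B : ℝ} (hI : 0 < I₀) (hB : 0 < B) {z : Fin 3 → ℝ}
    (hz : z ∈ region I₀ B) (T : ℝ) (η : Fin 3 → ℝ) :
    ContinuousAt (fun p : ℝ × (Fin 3 → ℝ) => innerTime I₀ B p.1 η p.2) (T, z) := by
  rw [ContinuousAt, tendsto_iff_dist_tendsto_zero]
  have hc : Continuous fun p : ℝ × (Fin 3 → ℝ) =>
      |p.1 - elapsed B η p.2 (innerTime I₀ B T η z)| / √I₀ := by
    have := (continuous_elapsed_param B (innerTime I₀ B T η z)).comp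
      (continuous_const.prodMk continuous_snd : Continuous fun p : ℝ × (Fin 3 → ℝ) => (η, p.2))
    exact ((continuous_fst.sub this).abs).div_const _
  refine squeeze_zero' (Eventually.of_forall fun _ => dist_nonneg) ?_
    (by simpa [elapsed_innerTime hI hB hz] using hc.tendsto (T, z))
  filter_upwards [continuousAt_snd ((isOpen_region I₀ B).mem_nhds hz)] with p hp
  exact abs_innerTime_sub_le hI hB hp p.1 η _

/-- The linear form `h ↦ -y(s)⁻¹ (∫₀ˢ exp (σ L) h dσ)_y`, the differential of `innerTime` by the
implicit function theorem. -/
noncomputable def innerTimeDeriv (B : ℝ) (η z : Fin 3 → ℝ) (s : ℝ) : Fin 3 → ℝ :=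
  -(((propagator B η s *ᵥ z) 2)⁻¹ • propagatorInt B η s 2)

theorem hasFDerivAt_elapsed (B : ℝ) (η z : Fin 3 → ℝ) (s : ℝ) :
    HasFDerivAt (fun p : ℝ × (Fin 3 → ℝ) => elapsed B η p.2 p.1)
      ((propagator B η s *ᵥ z) 2 • ContinuousLinearMap.fst ℝ ℝ (Fin 3 → ℝ)
        + (ContinuousLinearMap.proj 2 ∘L
          LinearMap.toContinuousLinearMap (propagatorInt B η s).mulVecLin) ∘L
            ContinuousLinearMap.snd ℝ ℝ (Fin 3 → ℝ)) (s, z) := by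
  have hlin : ∀ A : Matrix (Fin 3) (Fin 3) ℝ, HasFDerivAt (fun p : ℝ × (Fin 3 → ℝ) => (A *ᵥ p.2) 2)
      ((ContinuousLinearMap.proj 2 ∘L LinearMap.toContinuousLinearMap A.mulVecLin) ∘L
        ContinuousLinearMap.snd ℝ ℝ (Fin 3 → ℝ)) (s, z) := fun A =>
    ((ContinuousLinearMap.proj 2 ∘L LinearMap.toContinuousLinearMap A.mulVecLin) ∘L
        ContinuousLinearMap.snd ℝ ℝ (Fin 3 → ℝ)).hasFDerivAt
  have hsc : ∀ {f : ℝ → ℝ} {f' : ℝ}, HasDerivAt f f' s → HasFDerivAt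
      (fun p : ℝ × (Fin 3 → ℝ) => f p.1) (f' • ContinuousLinearMap.fst ℝ ℝ (Fin 3 → ℝ)) (s, z) :=
    fun hf => hf.comp_hasFDerivAt (s, z) (hasFDerivAt_fst (p := (s, z)))
  have h := (((hsc (hasDerivAt_id s)).mul (hlin 1)).add
    ((hsc (hasDerivAt_propC (genDisc B η) s)).mul (hlin (genMatrix B η)))).add
    ((hsc (hasDerivAt_propK (genDisc B η) s)).mul (hlin (genMatrix B η * genMatrix B η)))
  refine (h.congr_of_eventuallyEq (Eventually.of_forall fun p => ?_)).congr_fderiv ?_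
  · simp [elapsed, propagatorInt_mulVec]
  · ext p <;>
      simp [propagator_mulVec, propagatorInt_mulVec]
    all_goals ring

theorem hasFDerivAt_innerTime {I₀ B : ℝ} (hI : 0 < I₀) (hB : 0 < B) {z : Fin 3 → ℝ}
    (hz : z ∈ region I₀ B) (T : ℝ) (η : Fin 3 → ℝ) :
    HasFDerivAt (fun z => innerTime I₀ B T η z)
      (LinearMap.toContinuousLinearMap
        (dotProductBilin ℝ ℝ (innerTimeDeriv B η z (innerTime I₀ B T η z)))) z := by
  set s := innerTime I₀ B T η z with hs
  set y := (propagator B η s *ᵥ z) 2 with hy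
  have hy0 : y ≠ 0 := (propagator_mem_region hI hB hz η s).1.ne'
  set φ : (Fin 3 → ℝ) →L[ℝ] ℝ := ContinuousLinearMap.proj 2 ∘L
    LinearMap.toContinuousLinearMap (propagatorInt B η s).mulVecLin with hφ
  -- the map `(s, z) ↦ (elapsed z s, z)` has the local inverse `(t, z) ↦ (innerTime t z, z)`
  let e : (ℝ × (Fin 3 → ℝ)) ≃L[ℝ] (ℝ × (Fin 3 → ℝ)) := ContinuousLinearEquiv.equivOfInverse
    ((y • ContinuousLinearMap.fst ℝ ℝ (Fin 3 → ℝ) + φ ∘L ContinuousLinearMap.snd ℝ ℝ _).prod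
      (ContinuousLinearMap.snd ℝ ℝ _))
    ((y⁻¹ • (ContinuousLinearMap.fst ℝ ℝ (Fin 3 → ℝ) - φ ∘L ContinuousLinearMap.snd ℝ ℝ _)).prod
      (ContinuousLinearMap.snd ℝ ℝ _))
    (fun p => by ext <;> simp [hy0]) (fun p => by ext <;> simp [hy0])
  have hG : HasFDerivAt (fun p : ℝ × (Fin 3 → ℝ) => (elapsed B η p.2 p.1, p.2))
      (e : (ℝ × (Fin 3 → ℝ)) →L[ℝ] (ℝ × (Fin 3 → ℝ))) (s, z) :=
    (hasFDerivAt_elapsed B η z s).prodMk hasFDerivAt_snd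
  have hinv := HasFDerivAt.of_local_left_inverse (a := (T, z))
    (g := fun p : ℝ × (Fin 3 → ℝ) => (innerTime I₀ B p.1 η p.2, p.2))
    ((continuousAt_innerTime hI hB hz T η).prodMk continuousAt_snd) hG (by
      filter_upwards [continuousAt_snd ((isOpen_region I₀ B).mem_nhds hz)] with p hp
      simp [elapsed_innerTime hI hB hp])
  refine ((hinv.comp z (hasFDerivAt_prodMk_right T z)).fst).congr_fderiv ?_
  ext h
  simp [e, φ, innerTimeDeriv, Matrix.mulVec]
  exact Or.inl rfl

/-- A rank-one perturbation of the propagator: the chain rule for `exp (s(z) L) z`. -/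
noncomputable def sliceFlowDeriv (B : ℝ) (η z : Fin 3 → ℝ) (s : ℝ) : Matrix (Fin 3) (Fin 3) ℝ :=
  propagator B η s * (1 + replicateCol Unit (genMatrix B η *ᵥ z)
    * replicateRow Unit (innerTimeDeriv B η z s))

theorem hasFDerivAt_sliceFlow {I₀ B : ℝ} (hI : 0 < I₀) (hB : 0 < B) {z : Fin 3 → ℝ}
    (hz : z ∈ region I₀ B) (T : ℝ) (η : Fin 3 → ℝ) :
    HasFDerivAt (sliceFlow I₀ B T η) (LinearMap.toContinuousLinearMap
      (toLin' (sliceFlowDeriv B η z (innerTime I₀ B T η z)))) z := by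
  have hs := hasFDerivAt_innerTime hI hB hz T η
  set s := innerTime I₀ B T η z
  have hlin : ∀ A : Matrix (Fin 3) (Fin 3) ℝ, HasFDerivAt (fun z => A *ᵥ z)
      (LinearMap.toContinuousLinearMap A.mulVecLin) z := fun A =>
    (LinearMap.toContinuousLinearMap A.mulVecLin).hasFDerivAt
  have hS := (hasDerivAt_propS (genDisc B η) s).comp_hasFDerivAt z hs
  have hC := (hasDerivAt_propC (genDisc B η) s).comp_hasFDerivAt z hs
  have h := ((hasFDerivAt_id z).add (hS.smul (hlin (genMatrix B η)))).add
    (hC.smul (hlin (genMatrix B η * genMatrix B η)))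
  refine (h.congr_of_eventuallyEq (Eventually.of_forall fun p => ?_)).congr_fderiv ?_
  · simp [sliceFlow, propagator_mulVec]
  · have hcol : ∀ h : Fin 3 → ℝ, sliceFlowDeriv B η z s *ᵥ h = propagator B η s *ᵥ h
        + (innerTimeDeriv B η z s ⬝ᵥ h) • (genMatrix B η *ᵥ (propagator B η s *ᵥ z)) := fun h => by
      rw [mulVec_mulVec, (commute_gen_propagator B η s).eq, ← mulVec_mulVec, sliceFlowDeriv,
        ← mulVec_mulVec, add_mulVec, one_mulVec, mulVec_add, ← mulVec_smul]
      congr 2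
      rw [← vecMulVec_eq, vecMulVec_mulVec]
      ext i
      simp [mul_comm]
    refine ContinuousLinearMap.ext fun h => ?_
    simp only [LinearMap.coe_toContinuousLinearMap', toLin'_apply]
    rw [hcol, mulVec_mulVec, gen_mul_propagator, add_mulVec, smul_mulVec, smul_mulVec,
      propagator_mulVec]
    simp [s]
    module

theorem det_sliceFlowDeriv {I₀ B : ℝ} (hI : 0 < I₀) (hB : 0 < B) {z : Fin 3 → ℝ}
    (hz : z ∈ region I₀ B) (η : Fin 3 → ℝ) (s : ℝ) :
    (sliceFlowDeriv B η z s).det = z 2 / (propagator B η s *ᵥ z) 2 := by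
  have hy0 : (propagator B η s *ᵥ z) 2 ≠ 0 := (propagator_mem_region hI hB hz η s).1.ne'
  have h : propagatorInt B η s 2 ⬝ᵥ (genMatrix B η *ᵥ z) = (propagator B η s *ᵥ z) 2 - z 2 := by
    have h1 := congrArg (fun A => (A *ᵥ z) 2) (propagatorInt_mul_gen B η s)
    simp only [← mulVec_mulVec, sub_mulVec, one_mulVec, Pi.sub_apply] at h1
    exact h1
  rw [sliceFlowDeriv, det_mul, det_propagator, det_one_add_replicateCol_mul_replicateRow,
    innerTimeDeriv, neg_dotProduct, smul_dotProduct, h]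
  rw [smul_eq_mul]
  field_simp
  ring

/-- The measure `y dN₁ dN₂ dy` on the region. -/
noncomputable def sliceMeasure (I₀ B : ℝ) : Measure (Fin 3 → ℝ) :=
  (volume.restrict (region I₀ B)).withDensity fun z => ENNReal.ofReal (z 2)

theorem sliceMeasure_apply {I₀ B : ℝ} {A : Set (Fin 3 → ℝ)} (hA : MeasurableSet A) :
    sliceMeasure I₀ B A = ∫⁻ z in A ∩ region I₀ B, ENNReal.ofReal (z 2) := by
  rw [sliceMeasure, withDensity_apply _ hA, Measure.restrict_restrict hA]

theorem measurePreserving_sliceFlow {I₀ B : ℝ} (hI : 0 < I₀) (hB : 0 < B) (T : ℝ)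
    (η : Fin 3 → ℝ) :
    MeasurePreserving (sliceFlow I₀ B T η) (sliceMeasure I₀ B) (sliceMeasure I₀ B) := by
  have hm : Measurable (sliceFlow I₀ B T η) := by
    have h := (measurable_sliceFlow hI hB T).comp (measurable_prodMk_left (x := η))
    simpa only [Function.comp_def] using h
  have hbij := bijOn_sliceFlow hI hB T η
  refine ⟨hm, Measure.ext fun A hA => ?_⟩
  have himg : sliceFlow I₀ B T η '' (sliceFlow I₀ B T η ⁻¹' A ∩ region I₀ B) = A ∩ region I₀ B := by
    rw [inter_comm, image_inter_preimage, hbij.image_eq, inter_comm]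
  have hmeas := (hm hA).inter (isOpen_region I₀ B).measurableSet
  have hder : ∀ z ∈ sliceFlow I₀ B T η ⁻¹' A ∩ region I₀ B, HasFDerivWithinAt (sliceFlow I₀ B T η)
      (LinearMap.toContinuousLinearMap (toLin' (sliceFlowDeriv B η z (innerTime I₀ B T η z))))
      (sliceFlow I₀ B T η ⁻¹' A ∩ region I₀ B) z := fun z hz =>
    (hasFDerivAt_sliceFlow hI hB (mem_of_mem_inter_right hz) T η).hasFDerivWithinAt
  have hcv := lintegral_image_eq_lintegral_abs_det_fderiv_mul volume hmeas hder
    (hbij.injOn.mono inter_subset_right) (fun z => ENNReal.ofReal (z 2))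
  rw [himg] at hcv
  rw [Measure.map_apply hm hA, sliceMeasure_apply (hm hA), sliceMeasure_apply hA, hcv]
  refine setLIntegral_congr_fun hmeas fun z hz => ?_
  have hy := (sliceFlow_mem_region hI hB hz.2 T η).1
  have hdet : (LinearMap.toContinuousLinearMap
      (toLin' (sliceFlowDeriv B η z (innerTime I₀ B T η z)))).det
        = z 2 / sliceFlow I₀ B T η z 2 := by
    rw [sliceFlow, ← det_sliceFlowDeriv hI hB hz.2 η (innerTime I₀ B T η z)]
    simp [ContinuousLinearMap.det]
  rw [hdet, abs_of_pos (div_pos hz.2.1 hy), ← ENNReal.ofReal_mul (div_pos hz.2.1 hy).le,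
    div_mul_cancel₀ _ hy.ne']

/-! ### The reduced equations and the first integrals -/

/-- The equations of motion `𝕀 𝐯̇ = 𝐦`, `𝐧̇ = 𝕁 𝐯` for the vector `V` of derivatives. -/
def MotionEqs (m I δ : ℝ) (x V : Fin 6 → ℝ) : Prop :=
  (m + δ) * V 0 - x 4 * V 2 = 1 / 2 * (x 3 * x 2 ^ 2 - δ * x 2 * x 1) ∧
  (m + δ) * V 1 + x 3 * V 2 = 1 / 2 * (x 4 * x 2 ^ 2 + δ * x 2 * x 0) ∧
  -x 4 * V 0 + x 3 * V 1 + (I + x 5) * V 2 = 1 / 2 * (x 2 * (x 3 * x 0 + x 4 * x 1)) ∧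
  V 3 = -(1 / 2) * (δ * x 0 + x 4 * x 2) ∧
  V 4 = -(1 / 2) * (δ * x 1 - x 3 * x 2) ∧
  V 5 = -(x 3 * x 0 + x 4 * x 1)

/-- Solving for the derivatives: the vector field is determined by the equations of motion. -/
theorem motionEqs_iff {m I δ : ℝ} (hm : 0 < m) (hI : 0 < I) (hδ : 0 < δ) {x : Fin 6 → ℝ}
    (hx : x ∈ phaseSpace δ) (V : Fin 6 → ℝ) :
    MotionEqs m I δ x V ↔ V = reducedField m I δ x := by
  have hdet : IsUnit (inertia m I δ x).det := (inertia_det_pos hm hI hδ hx).ne'.isUnit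
  have htop : ![V 0, V 1, V 2] = (inertia m I δ x)⁻¹ *ᵥ forceVector δ x ↔
      inertia m I δ x *ᵥ ![V 0, V 1, V 2] = forceVector δ x := by
    constructor
    · intro h
      rw [h, mulVec_mulVec, mul_nonsing_inv _ hdet, one_mulVec]
    · intro h
      rw [← h, mulVec_mulVec, nonsing_inv_mul _ hdet, one_mulVec]
  have hsplit : V = reducedField m I δ x ↔
      ![V 0, V 1, V 2] = (inertia m I δ x)⁻¹ *ᵥ forceVector δ x ∧
      ![V 3, V 4, V 5] = kinematicMatrix δ x *ᵥ velocity x := by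
    constructor
    · rintro rfl
      constructor <;> ext i <;> fin_cases i <;> rfl
    · rintro ⟨h, h'⟩
      ext i
      fin_cases i
      exacts [congrFun h 0, congrFun h 1, congrFun h 2, congrFun h' 0, congrFun h' 1, congrFun h' 2]
  rw [hsplit, htop, MotionEqs]
  simp only [funext_iff, Fin.forall_fin_succ]
  simp [inertia, forceVector, kinematicMatrix, velocity, Matrix.mulVec, dotProduct,
    Fin.sum_univ_three, -one_div]
  constructor
  · rintro ⟨h0, h1, h2, h3, h4, h5⟩
    refine ⟨⟨?_, ?_, ?_⟩, ?_, ?_, ?_⟩ <;> linarith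
  · rintro ⟨⟨h0, h1, h2⟩, h3, h4, h5⟩
    refine ⟨?_, ?_, ?_, ?_, ?_, ?_⟩ <;> linarith

theorem motionEqs_reducedField {m I δ : ℝ} (hm : 0 < m) (hI : 0 < I) (hδ : 0 < δ)
    {x : Fin 6 → ℝ} (hx : x ∈ phaseSpace δ) : MotionEqs m I δ x (reducedField m I δ x) :=
  (motionEqs_iff hm hI hδ hx _).2 rfl

theorem eq_of_hasDerivWithinAt_zero {J : Set ℝ} (hJ : J.OrdConnected) {f : ℝ → ℝ}
    (hf : ∀ t ∈ J, HasDerivWithinAt f 0 J t) {s t : ℝ} (hs : s ∈ J) (ht : t ∈ J) :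
    f s = f t := by
  have := hJ.convex.norm_image_sub_le_of_norm_hasDerivWithin_le (C := 0) hf
    (fun _ _ => by simp) ht hs
  simpa [sub_eq_zero] using this

/-- Constancy of `f` along solutions only needs the linear equations of motion, not `𝕀⁻¹`. -/
theorem isFirstIntegral_of_deriv {m I δ : ℝ} (hm : 0 < m) (hI : 0 < I) (hδ : 0 < δ)
    {f : (Fin 6 → ℝ) → ℝ}
    (hf : ∀ (J : Set ℝ) (γ : ℝ → Fin 6 → ℝ) (t : ℝ) (V : Fin 6 → ℝ), γ t ∈ phaseSpace δ →
      MotionEqs m I δ (γ t) V → (∀ i, HasDerivWithinAt (fun t => γ t i) (V i) J t) →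
      HasDerivWithinAt (fun t => f (γ t)) 0 J t) :
    IsFirstIntegral (reducedField m I δ) (phaseSpace δ) f := fun J γ hJ hγ _ hs _ ht =>
  eq_of_hasDerivWithinAt_zero hJ (f := fun t => f (γ t)) (fun u hu => hf J γ u _ (hγ.2 u hu)
    (motionEqs_reducedField hm hI hδ (hγ.2 u hu)) (hasDerivWithinAt_pi.1 (hγ.1 u hu))) hs ht

theorem isFirstIntegral_f₁ {m I δ : ℝ} (hm : 0 < m) (hI : 0 < I) (hδ : 0 < δ) :
    IsFirstIntegral (reducedField m I δ) (phaseSpace δ) (f₁ m δ) := by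
  refine isFirstIntegral_of_deriv hm hI hδ fun J γ t V _ ⟨h0, h1, h2, h3, h4, h5⟩ hV => ?_
  refine (((hV 0).const_mul (m + δ)).sub ((hV 2).mul (hV 4))).congr_deriv ?_
  rw [h4]
  linear_combination h0

theorem isFirstIntegral_f₂ {m I δ : ℝ} (hm : 0 < m) (hI : 0 < I) (hδ : 0 < δ) :
    IsFirstIntegral (reducedField m I δ) (phaseSpace δ) (f₂ m δ) := by
  refine isFirstIntegral_of_deriv hm hI hδ fun J γ t V _ ⟨h0, h1, h2, h3, h4, h5⟩ hV => ?_
  refine (((hV 1).const_mul (m + δ)).add ((hV 2).mul (hV 3))).congr_deriv ?_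
  rw [h3]
  linear_combination h1

theorem isFirstIntegral_f₃ {m I δ : ℝ} (hm : 0 < m) (hI : 0 < I) (hδ : 0 < δ) :
    IsFirstIntegral (reducedField m I δ) (phaseSpace δ) (f₃ δ) := by
  refine isFirstIntegral_of_deriv hm hI hδ fun J γ t V _ ⟨h0, h1, h2, h3, h4, h5⟩ hV => ?_
  refine (((hV 5).const_mul δ).sub (((hV 3).pow 2).add ((hV 4).pow 2))).congr_deriv ?_
  rw [h3, h4, h5]
  simp
  ring

theorem isFirstIntegral_f₄ {m I δ : ℝ} (hm : 0 < m) (hI : 0 < I) (hδ : 0 < δ) :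
    IsFirstIntegral (reducedField m I δ) (phaseSpace δ) (f₄ m I δ) := by
  refine isFirstIntegral_of_deriv hm hI hδ fun J γ t V _ ⟨h0, h1, h2, h3, h4, h5⟩ hV => ?_
  refine ((((((hV 5).const_add I).const_mul (1 / 2)).mul ((hV 2).pow 2)).add
    ((((hV 0).pow 2).add ((hV 1).pow 2)).const_mul (1 / 2 * (m + δ)))).add
    ((hV 2).mul (((hV 3).mul (hV 1)).sub ((hV 4).mul (hV 0))))).congr_deriv ?_
  rw [h3, h4, h5]
  simp
  linear_combination γ t 0 * h0 + γ t 1 * h1 + γ t 2 * h2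

/-! ### Functional independence -/

theorem isOpen_phaseSpace (δ : ℝ) : IsOpen (phaseSpace δ) :=
  isOpen_lt (f := fun x : Fin 6 → ℝ => x 3 ^ 2 + x 4 ^ 2) (g := fun x => δ * x 5)
    (by fun_prop) (by fun_prop)

theorem det_inertia (m I δ : ℝ) (x : Fin 6 → ℝ) :
    (inertia m I δ x).det = (m + δ) * ((m + δ) * (I + x 5) - (x 3 ^ 2 + x 4 ^ 2)) := by
  rw [inertia, Matrix.det_fin_three]
  simp
  ring

/-- Where `v_φ ≠ 0` the minor of the Jacobian of the first integrals for the variables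
`v_x, v_y, v_φ, M` is nonzero: it equals `± δ v_φ det 𝕀`. -/
theorem linearIndependent_fderiv {m I δ : ℝ} (hm : 0 < m) (hI : 0 < I) (hδ : 0 < δ)
    {x : Fin 6 → ℝ} (hx : x ∈ phaseSpace δ) (hw : x 2 ≠ 0) :
    LinearIndependent ℝ
      (fun i => fderiv ℝ ((![f₁ m δ, f₂ m δ, f₃ δ, f₄ m I δ] : Fin 4 → (Fin 6 → ℝ) → ℝ) i) x) := by
  have hp : ∀ i : Fin 6, HasFDerivAt (fun x : Fin 6 → ℝ => x i)
      (ContinuousLinearMap.proj (R := ℝ) (φ := fun _ : Fin 6 => ℝ) i) x := fun i =>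
    hasFDerivAt_apply i x
  have d1 : HasFDerivAt (f₁ m δ) _ x := ((hp 0).const_mul (m + δ)).sub ((hp 2).mul (hp 4))
  have d2 : HasFDerivAt (f₂ m δ) _ x := ((hp 1).const_mul (m + δ)).add ((hp 2).mul (hp 3))
  have d3 : HasFDerivAt (f₃ δ) _ x :=
    ((hp 5).const_mul δ).sub (((hp 3).pow 2).add ((hp 4).pow 2))
  have d4 : HasFDerivAt (f₄ m I δ) _ x := (((((hp 5).const_add I).const_mul (1 / 2)).mul
    ((hp 2).pow 2)).add ((((hp 0).pow 2).add ((hp 1).pow 2)).const_mul (1 / 2 * (m + δ)))).add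
    ((hp 2).mul (((hp 3).mul (hp 1)).sub ((hp 4).mul (hp 0))))
  have hdet := inertia_det_pos hm hI hδ hx
  rw [det_inertia] at hdet
  have ha : m + δ ≠ 0 := (add_pos hm hδ).ne'
  have hD : (m + δ) * (I + x 5) - (x 3 ^ 2 + x 4 ^ 2) ≠ 0 := fun h => by simp [h] at hdet
  rw [Fintype.linearIndependent_iff]
  intro g hg
  have hg' : ∀ v : Fin 6 → ℝ, g 0 * fderiv ℝ (f₁ m δ) x v + g 1 * fderiv ℝ (f₂ m δ) x v
      + g 2 * fderiv ℝ (f₃ δ) x v + g 3 * fderiv ℝ (f₄ m I δ) x v = 0 := fun v => by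
    have := congrArg (fun L : (Fin 6 → ℝ) →L[ℝ] ℝ => L v) hg
    simpa [Fin.sum_univ_four] using this
  rw [d1.fderiv, d2.fderiv, d3.fderiv, d4.fderiv] at hg'
  have e0 := hg' (Pi.single 0 1)
  have e1 := hg' (Pi.single 1 1)
  have e2 := hg' (Pi.single 2 1)
  have e5 := hg' (Pi.single 5 1)
  simp at e0 e1 e2 e5
  have k3 : g 3 = 0 := by
    -- the combination of the columns that isolates the factor `v_φ det 𝕀`
    have : (x 2 * ((m + δ) * (I + x 5) - (x 3 ^ 2 + x 4 ^ 2))) * g 3 = 0 := by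
      linear_combination (m + δ) * e2 + x 4 * e0 - x 3 * e1
    exact (mul_eq_zero.1 this).resolve_left (mul_ne_zero hw hD)
  simp [k3, ha, hδ.ne'] at e0 e1 e5
  intro i
  fin_cases i <;> assumption

theorem functionallyIndependentOn {m I δ : ℝ} (hm : 0 < m) (hI : 0 < I) (hδ : 0 < δ) :
    FunctionallyIndependentOn ![f₁ m δ, f₂ m δ, f₃ δ, f₄ m I δ] (phaseSpace δ) := by
  have hdense : Dense {x : Fin 6 → ℝ | x 2 ≠ 0} := by
    have : IsOpenMap fun x : Fin 6 → ℝ => x 2 := isOpenMap_eval 2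
    exact (dense_compl_singleton (0 : ℝ)).preimage this
  refine (hdense.open_subset_closure_inter (isOpen_phaseSpace δ)).trans (closure_mono ?_)
  rintro x ⟨hx, hw⟩
  exact ⟨hx, linearIndependent_fderiv hm hI hδ hx hw⟩

/-! ### Coordinates in which the system is linear up to a change of time -/

/-- The constant `B` in the conserved quadratic form `y² - B (N₁² + N₂²)`. -/
noncomputable def coefB (m δ : ℝ) : ℝ := m / (δ * (m + δ))

/-- The factor in `p = c f₁`, `q = c f₂`. -/
noncomputable def coefC (m δ : ℝ) : ℝ := δ / (2 * (m + δ))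

/-- The factor in `r = κ v_φ y`. -/
noncomputable def coefK (m δ : ℝ) : ℝ := (m + 2 * δ) / (2 * (m + δ))

/-- `y = √(det 𝕀) / (m + δ)`. -/
noncomputable def yCoord (m I δ : ℝ) (x : Fin 6 → ℝ) : ℝ :=
  √(I + x 5 - (x 3 ^ 2 + x 4 ^ 2) / (m + δ))

/-- The constants of motion `(p, q, r)`. -/
noncomputable def parPart (m I δ : ℝ) (x : Fin 6 → ℝ) : Fin 3 → ℝ :=
  ![coefC m δ * f₁ m δ x, coefC m δ * f₂ m δ x, coefK m δ * (x 2 * yCoord m I δ x)]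

/-- The variables `(N₁, N₂, y)`. -/
noncomputable def posPart (m I δ : ℝ) (x : Fin 6 → ℝ) : Fin 3 → ℝ :=
  ![x 3, x 4, yCoord m I δ x]

/-- The point of the phase space with the coordinates `η = (p, q, r)` and `z = (N₁, N₂, y)`. -/
noncomputable def ofCoords (m I δ : ℝ) (η z : Fin 3 → ℝ) : Fin 6 → ℝ :=
  ![(η 0 / coefC m δ + η 2 / (coefK m δ * z 2) * z 1) / (m + δ),
    (η 1 / coefC m δ - η 2 / (coefK m δ * z 2) * z 0) / (m + δ),
    η 2 / (coefK m δ * z 2), z 0, z 1, z 2 ^ 2 - I + (z 0 ^ 2 + z 1 ^ 2) / (m + δ)]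

theorem genMatrix_mulVec (B : ℝ) (η z : Fin 3 → ℝ) :
    genMatrix B η *ᵥ z = ![-(η 2 * z 1) - η 0 * z 2, η 2 * z 0 - η 1 * z 2,
      -(B * (η 0 * z 0 + η 1 * z 1))] := by
  ext i
  fin_cases i <;> simp [genMatrix, mulVec, dotProduct, Fin.sum_univ_three] <;> ring

section Coords

variable {m I δ : ℝ}

theorem coefB_pos (hm : 0 < m) (hδ : 0 < δ) : 0 < coefB m δ := by unfold coefB; positivity

theorem coefC_pos (hm : 0 < m) (hδ : 0 < δ) : 0 < coefC m δ := by unfold coefC; positivity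

theorem coefK_pos (hm : 0 < m) (hδ : 0 < δ) : 0 < coefK m δ := by unfold coefK; positivity

theorem radicand_eq (hm : 0 < m) (hδ : 0 < δ) (x : Fin 6 → ℝ) :
    I + x 5 - (x 3 ^ 2 + x 4 ^ 2) / (m + δ)
      = I + coefB m δ * (x 3 ^ 2 + x 4 ^ 2) + (δ * x 5 - (x 3 ^ 2 + x 4 ^ 2)) / δ := by
  have : m + δ ≠ 0 := (add_pos hm hδ).ne'
  unfold coefB
  field_simp
  ring

theorem radicand_gt (hm : 0 < m) (hδ : 0 < δ) {x : Fin 6 → ℝ} (hx : x ∈ phaseSpace δ) :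
    I + coefB m δ * (x 3 ^ 2 + x 4 ^ 2) < I + x 5 - (x 3 ^ 2 + x 4 ^ 2) / (m + δ) := by
  have hx' : x 3 ^ 2 + x 4 ^ 2 < δ * x 5 := hx
  have : 0 < (δ * x 5 - (x 3 ^ 2 + x 4 ^ 2)) / δ := div_pos (sub_pos.2 hx') hδ
  rw [radicand_eq hm hδ]
  linarith

theorem radicand_pos (hm : 0 < m) (hI : 0 < I) (hδ : 0 < δ) {x : Fin 6 → ℝ}
    (hx : x ∈ phaseSpace δ) : 0 < I + x 5 - (x 3 ^ 2 + x 4 ^ 2) / (m + δ) := by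
  refine lt_trans ?_ (radicand_gt hm hδ hx)
  have := coefB_pos hm hδ
  positivity

theorem yCoord_pos (hm : 0 < m) (hI : 0 < I) (hδ : 0 < δ) {x : Fin 6 → ℝ}
    (hx : x ∈ phaseSpace δ) : 0 < yCoord m I δ x := Real.sqrt_pos.2 (radicand_pos hm hI hδ hx)

theorem yCoord_sq (hm : 0 < m) (hI : 0 < I) (hδ : 0 < δ) {x : Fin 6 → ℝ}
    (hx : x ∈ phaseSpace δ) :
    yCoord m I δ x ^ 2 = I + x 5 - (x 3 ^ 2 + x 4 ^ 2) / (m + δ) :=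
  Real.sq_sqrt (radicand_pos hm hI hδ hx).le

/-- The condition `δ M > N₁² + N₂²` becomes `y² > I + B (N₁² + N₂²)`. -/
theorem posPart_mem_region (hm : 0 < m) (hI : 0 < I) (hδ : 0 < δ) {x : Fin 6 → ℝ}
    (hx : x ∈ phaseSpace δ) : posPart m I δ x ∈ region I (coefB m δ) := by
  refine ⟨yCoord_pos hm hI hδ hx, ?_⟩
  simpa [posPart, yCoord_sq hm hI hδ hx] using radicand_gt hm hδ hx

theorem ofCoords_mem_phaseSpace (hm : 0 < m) (hδ : 0 < δ) (η : Fin 3 → ℝ) {z : Fin 3 → ℝ}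
    (hz : z ∈ region I (coefB m δ)) : ofCoords m I δ η z ∈ phaseSpace δ := by
  have h := hz.2
  have ha : m + δ ≠ 0 := (add_pos hm hδ).ne'
  have h2 : δ * (z 2 ^ 2 - I + (z 0 ^ 2 + z 1 ^ 2) / (m + δ)) - (z 0 ^ 2 + z 1 ^ 2)
      = δ * (z 2 ^ 2 - (I + coefB m δ * (z 0 ^ 2 + z 1 ^ 2))) := by
    unfold coefB
    field_simp
    ring
  have h3 := mul_pos hδ (sub_pos.2 h)
  change z 0 ^ 2 + z 1 ^ 2 < δ * (z 2 ^ 2 - I + (z 0 ^ 2 + z 1 ^ 2) / (m + δ))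
  linarith

theorem yCoord_ofCoords (η : Fin 3 → ℝ) {z : Fin 3 → ℝ}
    (hz : 0 < z 2) : yCoord m I δ (ofCoords m I δ η z) = z 2 := by
  have : I + (z 2 ^ 2 - I + (z 0 ^ 2 + z 1 ^ 2) / (m + δ)) - (z 0 ^ 2 + z 1 ^ 2) / (m + δ)
      = z 2 ^ 2 := by ring
  simp [yCoord, ofCoords, this, Real.sqrt_sq hz.le]

theorem posPart_ofCoords (η : Fin 3 → ℝ) {z : Fin 3 → ℝ} (hz : 0 < z 2) :
    posPart m I δ (ofCoords m I δ η z) = z := by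
  ext i
  fin_cases i
  · rfl
  · rfl
  · exact yCoord_ofCoords η hz

theorem parPart_ofCoords (hm : 0 < m) (hδ : 0 < δ) (η : Fin 3 → ℝ) {z : Fin 3 → ℝ}
    (hz : 0 < z 2) : parPart m I δ (ofCoords m I δ η z) = η := by
  have ha : m + δ ≠ 0 := (add_pos hm hδ).ne'
  have hc := (coefC_pos hm hδ).ne'
  have hk := (coefK_pos hm hδ).ne'
  have hy := yCoord_ofCoords (m := m) (I := I) (δ := δ) η hz
  ext i
  fin_cases i <;> simp [parPart, hy, f₁, f₂] <;> simp [ofCoords] <;> field_simp <;> ring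

theorem ofCoords_coords (hm : 0 < m) (hI : 0 < I) (hδ : 0 < δ) {x : Fin 6 → ℝ}
    (hx : x ∈ phaseSpace δ) : ofCoords m I δ (parPart m I δ x) (posPart m I δ x) = x := by
  have ha : m + δ ≠ 0 := (add_pos hm hδ).ne'
  have hc := (coefC_pos hm hδ).ne'
  have hk := (coefK_pos hm hδ).ne'
  have hy := (yCoord_pos hm hI hδ hx).ne'
  have hy2 := yCoord_sq hm hI hδ hx
  ext i
  fin_cases i <;> simp [ofCoords, parPart, posPart, f₁, f₂]
  · field_simp; ring
  · field_simp; ring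
  · field_simp
  · rw [hy2]; ring

theorem hasDerivWithinAt_yCoord (hm : 0 < m) (hI : 0 < I) (hδ : 0 < δ) {J : Set ℝ}
    {γ : ℝ → Fin 6 → ℝ} {t : ℝ} {V : Fin 6 → ℝ} (hx : γ t ∈ phaseSpace δ)
    (hV : ∀ i, HasDerivWithinAt (fun t => γ t i) (V i) J t) :
    HasDerivWithinAt (fun t => yCoord m I δ (γ t))
      ((V 5 - (2 * γ t 3 * V 3 + 2 * γ t 4 * V 4) / (m + δ)) / (2 * yCoord m I δ (γ t))) J t := by
  have h := ((hV 5).const_add I).sub ((((hV 3).pow 2).add ((hV 4).pow 2)).div_const (m + δ))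
  refine (h.sqrt (radicand_pos hm hI hδ hx).ne').congr_deriv ?_
  simp [yCoord]

/-- The third constant of motion: `v_φ y` does not change. -/
theorem hasDerivWithinAt_par_two (hm : 0 < m) (hI : 0 < I) (hδ : 0 < δ) {J : Set ℝ}
    {γ : ℝ → Fin 6 → ℝ} {t : ℝ} {V : Fin 6 → ℝ} (hx : γ t ∈ phaseSpace δ)
    (hE : MotionEqs m I δ (γ t) V) (hV : ∀ i, HasDerivWithinAt (fun t => γ t i) (V i) J t) :
    HasDerivWithinAt (fun t => γ t 2 * yCoord m I δ (γ t)) 0 J t := by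
  refine ((hV 2).mul (hasDerivWithinAt_yCoord hm hI hδ hx hV)).congr_deriv ?_
  have ha : m + δ ≠ 0 := (add_pos hm hδ).ne'
  have hy := yCoord_pos hm hI hδ hx
  have hy2 := yCoord_sq hm hI hδ hx
  generalize yCoord m I δ (γ t) = y at *
  generalize γ t = x at *
  obtain ⟨h0, h1, h2, h3, h4, h5⟩ := hE
  -- Cramer's rule for `v̇_φ`
  have key : V 2 * y ^ 2 = 1 / 2 * (m / (m + δ)) * x 2 * (x 3 * x 0 + x 4 * x 1) := by
    rw [hy2]
    field_simp
    linear_combination 2 * (m + δ) * h2 + 2 * x 4 * h0 - 2 * x 3 * h1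
  rw [h3, h4, h5]
  field_simp at key ⊢
  linear_combination key

/-- In the coordinates a solution solves the linear system up to the change of time. -/
theorem hasDerivWithinAt_posPart (hm : 0 < m) (hI : 0 < I) (hδ : 0 < δ) {J : Set ℝ}
    {γ : ℝ → Fin 6 → ℝ} {t : ℝ} {V : Fin 6 → ℝ} (hx : γ t ∈ phaseSpace δ)
    (hE : MotionEqs m I δ (γ t) V) (hV : ∀ i, HasDerivWithinAt (fun t => γ t i) (V i) J t) :
    HasDerivWithinAt (fun t => posPart m I δ (γ t)) ((posPart m I δ (γ t) 2)⁻¹ •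
      (genMatrix (coefB m δ) (parPart m I δ (γ t)) *ᵥ posPart m I δ (γ t))) J t := by
  have ha : m + δ ≠ 0 := (add_pos hm hδ).ne'
  have hy := yCoord_pos hm hI hδ hx
  have hyd := hasDerivWithinAt_yCoord hm hI hδ hx hV
  obtain ⟨h0, h1, h2, h3, h4, h5⟩ := hE
  refine hasDerivWithinAt_pi.2 fun i => ?_
  fin_cases i
  · refine (hV 3).congr_deriv ?_
    simp [posPart, parPart, genMatrix, f₁, f₂, h3]
    unfold coefC coefK
    field_simp
    ring
  · refine (hV 4).congr_deriv ?_
    simp [posPart, parPart, genMatrix, f₁, f₂, h4]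
    unfold coefC coefK
    field_simp
    ring
  · refine hyd.congr_deriv ?_
    simp [posPart, parPart, genMatrix, f₁, f₂, h3, h4, h5]
    unfold coefC coefB
    field_simp
    ring

theorem hasDerivAt_fin_six {f : ℝ → Fin 6 → ℝ} {d₀ d₁ d₂ d₃ d₄ d₅ t : ℝ}
    (h₀ : HasDerivAt (fun t => f t 0) d₀ t) (h₁ : HasDerivAt (fun t => f t 1) d₁ t)
    (h₂ : HasDerivAt (fun t => f t 2) d₂ t) (h₃ : HasDerivAt (fun t => f t 3) d₃ t)
    (h₄ : HasDerivAt (fun t => f t 4) d₄ t) (h₅ : HasDerivAt (fun t => f t 5) d₅ t) :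
    HasDerivAt f ![d₀, d₁, d₂, d₃, d₄, d₅] t :=
  hasDerivAt_pi.2 fun i => by fin_cases i <;> assumption

/-- A curve in the region that solves the system for frozen parameters gives a solution. -/
theorem hasDerivAt_ofCoords (hm : 0 < m) (hI : 0 < I) (hδ : 0 < δ) {η : Fin 3 → ℝ}
    {ζ : ℝ → Fin 3 → ℝ} {t : ℝ} (hmem : ζ t ∈ region I (coefB m δ))
    (hζ : HasDerivAt ζ ((ζ t 2)⁻¹ • (genMatrix (coefB m δ) η *ᵥ ζ t)) t) :
    HasDerivAt (fun t => ofCoords m I δ η (ζ t))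
      (reducedField m I δ (ofCoords m I δ η (ζ t))) t := by
  have ha : m + δ ≠ 0 := (add_pos hm hδ).ne'
  have hc := (coefC_pos hm hδ).ne'
  have hk := (coefK_pos hm hδ).ne'
  have hy := hmem.1
  have hd := hasDerivAt_pi.1 hζ
  have hw := (hasDerivAt_const t (η 2)).fun_div ((hd 2).const_mul (coefK m δ))
    (mul_pos (coefK_pos hm hδ) hy).ne'
  have hvx := ((hw.fun_mul (hd 1)).const_add (η 0 / coefC m δ)).div_const (m + δ)
  have hvy := ((hw.fun_mul (hd 0)).const_sub (η 1 / coefC m δ)).div_const (m + δ)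
  have hM := (((hd 2).fun_pow 2).sub_const I).fun_add
    ((((hd 0).fun_pow 2).fun_add ((hd 1).fun_pow 2)).div_const (m + δ))
  have hall := hasDerivAt_fin_six (f := fun t => ofCoords m I δ η (ζ t))
    hvx hvy hw (hd 0) (hd 1) hM
  refine hall.congr_deriv ((motionEqs_iff hm hI hδ (ofCoords_mem_phaseSpace hm hδ η hmem) _).1 ?_)
  generalize ζ t = z at *
  refine ⟨?_, ?_, ?_, ?_, ?_, ?_⟩
  all_goals
    simp only [genMatrix_mulVec]
    simp [ofCoords, coefC, coefK, coefB]
    field_simp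
    ring

end Coords

/-! ### The flow on the phase space -/

/-- The flow of the reduced system: the flow for frozen parameters in the coordinates
`(p, q, r; N₁, N₂, y)`. -/
noncomputable def flow (m I δ T : ℝ) (x : Fin 6 → ℝ) : Fin 6 → ℝ :=
  ofCoords m I δ (parPart m I δ x)
    (sliceFlow I (coefB m δ) T (parPart m I δ x) (posPart m I δ x))

section Flow

variable {m I δ : ℝ}

theorem flow_mem_phaseSpace (hm : 0 < m) (hI : 0 < I) (hδ : 0 < δ) {x : Fin 6 → ℝ}
    (hx : x ∈ phaseSpace δ) (T : ℝ) : flow m I δ T x ∈ phaseSpace δ :=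
  ofCoords_mem_phaseSpace hm hδ _
    (sliceFlow_mem_region hI (coefB_pos hm hδ) (posPart_mem_region hm hI hδ hx) T _)

theorem flow_zero (hm : 0 < m) (hI : 0 < I) (hδ : 0 < δ) {x : Fin 6 → ℝ}
    (hx : x ∈ phaseSpace δ) : flow m I δ 0 x = x := by
  rw [flow, sliceFlow_zero hI (coefB_pos hm hδ) (posPart_mem_region hm hI hδ hx),
    ofCoords_coords hm hI hδ hx]

theorem hasDerivAt_flow (hm : 0 < m) (hI : 0 < I) (hδ : 0 < δ) {x : Fin 6 → ℝ}
    (hx : x ∈ phaseSpace δ) (t : ℝ) :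
    HasDerivAt (fun t => flow m I δ t x) (reducedField m I δ (flow m I δ t x)) t :=
  hasDerivAt_ofCoords hm hI hδ
    (sliceFlow_mem_region hI (coefB_pos hm hδ) (posPart_mem_region hm hI hδ hx) t _)
    (hasDerivAt_sliceFlow hI (coefB_pos hm hδ) (posPart_mem_region hm hI hδ hx) t _)

theorem parPart_flow (hm : 0 < m) (hI : 0 < I) (hδ : 0 < δ) {x : Fin 6 → ℝ}
    (hx : x ∈ phaseSpace δ) (T : ℝ) : parPart m I δ (flow m I δ T x) = parPart m I δ x :=
  parPart_ofCoords hm hδ _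
    (sliceFlow_mem_region hI (coefB_pos hm hδ) (posPart_mem_region hm hI hδ hx) T _).1

theorem posPart_flow (hm : 0 < m) (hI : 0 < I) (hδ : 0 < δ) {x : Fin 6 → ℝ}
    (hx : x ∈ phaseSpace δ) (T : ℝ) : posPart m I δ (flow m I δ T x)
      = sliceFlow I (coefB m δ) T (parPart m I δ x) (posPart m I δ x) :=
  posPart_ofCoords _
    (sliceFlow_mem_region hI (coefB_pos hm hδ) (posPart_mem_region hm hI hδ hx) T _).1

theorem flow_neg (hm : 0 < m) (hI : 0 < I) (hδ : 0 < δ) {x : Fin 6 → ℝ}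
    (hx : x ∈ phaseSpace δ) (T : ℝ) : flow m I δ (-T) (flow m I δ T x) = x := by
  rw [flow, parPart_flow hm hI hδ hx, posPart_flow hm hI hδ hx,
    sliceFlow_neg hI (coefB_pos hm hδ) (posPart_mem_region hm hI hδ hx),
    ofCoords_coords hm hI hδ hx]

theorem parPart_eq_of_isSolutionOn (hm : 0 < m) (hI : 0 < I) (hδ : 0 < δ) {J : Set ℝ}
    (hJ : J.OrdConnected) {γ : ℝ → Fin 6 → ℝ}
    (hγ : IsSolutionOn (reducedField m I δ) (phaseSpace δ) γ J) {s t : ℝ} (hs : s ∈ J)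
    (ht : t ∈ J) : parPart m I δ (γ s) = parPart m I δ (γ t) := by
  have h1 := isFirstIntegral_f₁ hm hI hδ J γ hJ hγ s hs t ht
  have h2 := isFirstIntegral_f₂ hm hI hδ J γ hJ hγ s hs t ht
  have h3 := eq_of_hasDerivWithinAt_zero hJ (f := fun t => γ t 2 * yCoord m I δ (γ t))
    (fun u hu => hasDerivWithinAt_par_two hm hI hδ (hγ.2 u hu)
      (motionEqs_reducedField hm hI hδ (hγ.2 u hu)) (hasDerivWithinAt_pi.1 (hγ.1 u hu))) hs ht
  simp only [parPart, h1, h2, h3]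

theorem eq_flow_of_isSolutionOn (hm : 0 < m) (hI : 0 < I) (hδ : 0 < δ) {T : ℝ}
    {γ : ℝ → Fin 6 → ℝ} (hγ : IsSolutionOn (reducedField m I δ) (phaseSpace δ) γ (uIcc 0 T)) :
    γ T = flow m I δ T (γ 0) := by
  have h0 : (0 : ℝ) ∈ uIcc 0 T := left_mem_uIcc
  have hT : T ∈ uIcc 0 T := right_mem_uIcc
  have hpar : ∀ t ∈ uIcc 0 T, parPart m I δ (γ t) = parPart m I δ (γ 0) := fun t ht =>
    parPart_eq_of_isSolutionOn hm hI hδ ordConnected_uIcc hγ ht h0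
  have := eq_sliceFlow hI (coefB_pos hm hδ) (η := parPart m I δ (γ 0)) (T := T)
    (γ := fun t => posPart m I δ (γ t))
    (fun t ht => posPart_mem_region hm hI hδ (hγ.2 t ht)) (fun t ht => by
      rw [← hpar t ht]
      exact hasDerivWithinAt_posPart hm hI hδ (hγ.2 t ht)
        (motionEqs_reducedField hm hI hδ (hγ.2 t ht)) (hasDerivWithinAt_pi.1 (hγ.1 t ht)))
  rw [flow, ← this, ← hpar T hT, ofCoords_coords hm hI hδ (hγ.2 T hT)]

/-! ### The invariant measure -/

/-- All six coordinates as one vector, for the change of variables formula. -/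
noncomputable def coordMap (m I δ : ℝ) (x : Fin 6 → ℝ) : Fin 6 → ℝ :=
  ![coefC m δ * f₁ m δ x, coefC m δ * f₂ m δ x, coefK m δ * (x 2 * yCoord m I δ x),
    x 3, x 4, yCoord m I δ x]

/-- The Jacobian matrix of `coordMap`. -/
noncomputable def coordJacobian (m I δ : ℝ) (x : Fin 6 → ℝ) : Matrix (Fin 6) (Fin 6) ℝ :=
  let a := m + δ
  let c := coefC m δ
  let k := coefK m δ
  let y := yCoord m I δ x
  !![c * a, 0, -(c * x 4), 0, -(c * x 2), 0;
     0, c * a, c * x 3, c * x 2, 0, 0;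
     0, 0, k * y, -(k * x 2 * (x 3 / (a * y))), -(k * x 2 * (x 4 / (a * y))), k * x 2 / (2 * y);
     0, 0, 0, 1, 0, 0;
     0, 0, 0, 0, 1, 0;
     0, 0, 0, -(x 3 / (a * y)), -(x 4 / (a * y)), 1 / (2 * y)]

theorem det_coordJacobian {x : Fin 6 → ℝ} (hy : yCoord m I δ x ≠ 0) :
    (coordJacobian m I δ x).det = (coefC m δ * (m + δ)) ^ 2 * coefK m δ / 2 := by
  simp [coordJacobian, det_succ_row_zero, Fin.sum_univ_succ, Fin.succAbove]
  field_simp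

theorem hasFDerivAt_coordMap (hm : 0 < m) (hI : 0 < I) (hδ : 0 < δ) {x : Fin 6 → ℝ}
    (hx : x ∈ phaseSpace δ) : HasFDerivAt (coordMap m I δ)
      (LinearMap.toContinuousLinearMap (toLin' (coordJacobian m I δ x))) x := by
  have ha : m + δ ≠ 0 := (add_pos hm hδ).ne'
  have hy := yCoord_pos hm hI hδ hx
  have hp : ∀ i : Fin 6, HasFDerivAt (fun x : Fin 6 → ℝ => x i)
      (ContinuousLinearMap.proj (R := ℝ) (φ := fun _ : Fin 6 => ℝ) i) x := fun i =>
    hasFDerivAt_apply i x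
  have hyd : HasFDerivAt (yCoord m I δ)
      ((1 / (2 * yCoord m I δ x)) • ContinuousLinearMap.proj (R := ℝ) (φ := fun _ : Fin 6 => ℝ) 5
        - (x 3 / ((m + δ) * yCoord m I δ x)) • ContinuousLinearMap.proj 3
        - (x 4 / ((m + δ) * yCoord m I δ x)) • ContinuousLinearMap.proj 4) x := by
    refine ((((hp 5).const_add I).sub
      ((((hp 3).pow 2).add ((hp 4).pow 2)).mul_const (m + δ)⁻¹)).sqrt
      (radicand_pos hm hI hδ hx).ne').congr_fderiv (ContinuousLinearMap.ext fun v => ?_)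
    have hs : √(I + x 5 - (x 3 ^ 2 + x 4 ^ 2) * (m + δ)⁻¹) = yCoord m I δ x := by
      rw [yCoord, div_eq_mul_inv]
    simp [hs]
    field_simp
    ring
  have d1 : HasFDerivAt (f₁ m δ) _ x := ((hp 0).const_mul (m + δ)).sub ((hp 2).mul (hp 4))
  have d2 : HasFDerivAt (f₂ m δ) _ x := ((hp 1).const_mul (m + δ)).add ((hp 2).mul (hp 3))
  refine hasFDerivAt_pi'.2 fun i => ?_
  fin_cases i
  · refine (d1.const_mul (coefC m δ)).congr_fderiv (ContinuousLinearMap.ext fun v => ?_)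
    simp [coordJacobian, dotProduct, Fin.sum_univ_succ]
    ring
  · refine (d2.const_mul (coefC m δ)).congr_fderiv (ContinuousLinearMap.ext fun v => ?_)
    simp [coordJacobian, dotProduct, Fin.sum_univ_succ]
    ring
  · refine (((hp 2).mul hyd).const_mul (coefK m δ)).congr_fderiv
      (ContinuousLinearMap.ext fun v => ?_)
    simp [coordJacobian, dotProduct, Fin.sum_univ_succ]
    ring
  · refine (hp 3).congr_fderiv (ContinuousLinearMap.ext fun v => ?_)
    simp [coordJacobian, dotProduct, Fin.sum_univ_succ]
  · refine (hp 4).congr_fderiv (ContinuousLinearMap.ext fun v => ?_)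
    simp [coordJacobian, dotProduct, Fin.sum_univ_succ]
  · refine hyd.congr_fderiv (ContinuousLinearMap.ext fun v => ?_)
    simp [coordJacobian, dotProduct, Fin.sum_univ_succ]
    ring

/-- The coordinates as a pair of parameters and variables. -/
noncomputable def coordPair (m I δ : ℝ) (x : Fin 6 → ℝ) : (Fin 3 → ℝ) × (Fin 3 → ℝ) :=
  (parPart m I δ x, posPart m I δ x)

theorem coordPair_mem (hm : 0 < m) (hI : 0 < I) (hδ : 0 < δ) {x : Fin 6 → ℝ}
    (hx : x ∈ phaseSpace δ) : coordPair m I δ x ∈ univ ×ˢ region I (coefB m δ) :=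
  ⟨mem_univ _, posPart_mem_region hm hI hδ hx⟩

theorem injOn_coordMap (hm : 0 < m) (hI : 0 < I) (hδ : 0 < δ) :
    InjOn (coordMap m I δ) (phaseSpace δ) := by
  intro x hx x' hx' h
  have h1 : parPart m I δ x = parPart m I δ x' := by
    simp only [parPart]
    exact congrArg (fun v : Fin 6 → ℝ => ![v 0, v 1, v 2]) h
  have h2 : posPart m I δ x = posPart m I δ x' := by
    simp only [posPart]
    exact congrArg (fun v : Fin 6 → ℝ => ![v 3, v 4, v 5]) h
  rw [← ofCoords_coords hm hI hδ hx, h1, h2, ofCoords_coords hm hI hδ hx']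

theorem sqrt_det_inertia (hm : 0 < m) (hδ : 0 < δ) (x : Fin 6 → ℝ) :
    √(inertia m I δ x).det = (m + δ) * yCoord m I δ x := by
  have ha : 0 < m + δ := add_pos hm hδ
  have : (inertia m I δ x).det
      = (m + δ) ^ 2 * (I + x 5 - (x 3 ^ 2 + x 4 ^ 2) / (m + δ)) := by
    rw [det_inertia]
    field_simp
  rw [this, Real.sqrt_mul (sq_nonneg _), Real.sqrt_sq ha.le, yCoord]

/-- Splitting a vector of `ℝ⁶` into two vectors of `ℝ³`. -/
noncomputable def splitEquiv : (Fin 6 → ℝ) ≃ᵐ (Fin 3 → ℝ) × (Fin 3 → ℝ) :=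
  (MeasurableEquiv.piCongrLeft (fun _ : Fin 3 ⊕ Fin 3 => ℝ)
    (finSumFinEquiv (m := 3) (n := 3)).symm).trans
      (MeasurableEquiv.sumPiEquivProdPi fun _ : Fin 3 ⊕ Fin 3 => ℝ)

theorem measurePreserving_splitEquiv : MeasurePreserving splitEquiv volume volume :=
  (volume_measurePreserving_sumPiEquivProdPi (fun _ : Fin 3 ⊕ Fin 3 => ℝ)).comp
    (volume_measurePreserving_piCongrLeft (fun _ : Fin 3 ⊕ Fin 3 => ℝ)
      (finSumFinEquiv (m := 3) (n := 3)).symm)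

theorem splitEquiv_apply (v : Fin 6 → ℝ) :
    splitEquiv v = (![v 0, v 1, v 2], ![v 3, v 4, v 5]) := by
  ext i <;> fin_cases i <;> rfl

/-- The measure `y dp dq dr dN₁ dN₂ dy` in the coordinates. -/
noncomputable def coordMeasure (I B : ℝ) : Measure ((Fin 3 → ℝ) × (Fin 3 → ℝ)) :=
  volume.prod (sliceMeasure I B)

theorem coordMeasure_apply (I B : ℝ) {D : Set ((Fin 3 → ℝ) × (Fin 3 → ℝ))}
    (hD : MeasurableSet D) : coordMeasure I B D
      = ∫⁻ p in D ∩ univ ×ˢ region I B, ENNReal.ofReal (p.2 2) := by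
  have hg : Measurable fun z : Fin 3 → ℝ => ENNReal.ofReal (z 2) :=
    (measurable_pi_apply 2).ennreal_ofReal
  have hprod : (volume : Measure (Fin 3 → ℝ)).prod (volume.restrict (region I B))
      = (volume : Measure ((Fin 3 → ℝ) × (Fin 3 → ℝ))).restrict (univ ×ˢ region I B) := by
    rw [Measure.volume_eq_prod, ← Measure.prod_restrict, Measure.restrict_univ]
  rw [coordMeasure, sliceMeasure, prod_withDensity_right hg, withDensity_apply _ hD, hprod,
    Measure.restrict_restrict hD]

theorem measurable_coordPair : Measurable (coordPair m I δ) := by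
  have hy : Measurable (yCoord m I δ) := by unfold yCoord; fun_prop
  refine Measurable.prodMk (measurable_pi_iff.2 fun i => ?_) (measurable_pi_iff.2 fun i => ?_)
  · fin_cases i <;> simp [parPart, f₁, f₂] <;> fun_prop
  · fin_cases i <;> simp [posPart] <;> fun_prop

theorem measurable_ofCoords :
    Measurable fun p : (Fin 3 → ℝ) × (Fin 3 → ℝ) => ofCoords m I δ p.1 p.2 := by
  refine measurable_pi_iff.2 fun i => ?_
  fin_cases i <;> simp [ofCoords] <;> fun_prop

theorem measurable_flow (hm : 0 < m) (hI : 0 < I) (hδ : 0 < δ) (T : ℝ) :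
    Measurable (flow m I δ T) := by
  have h1 := measurable_coordPair (m := m) (I := I) (δ := δ)
  have h2 := (measurable_sliceFlow hI (coefB_pos hm hδ) T).comp h1
  exact measurable_ofCoords.comp ((measurable_fst.comp h1).prodMk h2)

theorem image_coordPair (hm : 0 < m) (hI : 0 < I) (hδ : 0 < δ) {A : Set (Fin 6 → ℝ)}
    (hA : A ⊆ phaseSpace δ) : coordPair m I δ '' A
      = (univ ×ˢ region I (coefB m δ)) ∩ (fun p => ofCoords m I δ p.1 p.2) ⁻¹' A := by
  ext ⟨η, z⟩
  constructor
  · rintro ⟨x, hx, hxe⟩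
    rw [← hxe]
    refine ⟨coordPair_mem hm hI hδ (hA hx), ?_⟩
    simpa [coordPair, ofCoords_coords hm hI hδ (hA hx)] using hx
  · rintro ⟨⟨-, hz⟩, hx⟩
    exact ⟨_, hx, Prod.ext (parPart_ofCoords hm hδ η hz.1) (posPart_ofCoords η hz.1)⟩

theorem measurableSet_image_coordPair (hm : 0 < m) (hI : 0 < I) (hδ : 0 < δ)
    {A : Set (Fin 6 → ℝ)} (hA : A ⊆ phaseSpace δ) (hAm : MeasurableSet A) :
    MeasurableSet (coordPair m I δ '' A) := by
  rw [image_coordPair hm hI hδ hA]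
  exact (MeasurableSet.univ.prod (isOpen_region I _).measurableSet).inter
    (measurable_ofCoords hAm)

/-- Up to a constant factor, the coordinates carry `√(det 𝕀) dx` to `y dp dq dr dN₁ dN₂ dy`. -/
theorem coordMeasure_image (hm : 0 < m) (hI : 0 < I) (hδ : 0 < δ) {A : Set (Fin 6 → ℝ)}
    (hA : A ⊆ phaseSpace δ) (hAm : MeasurableSet A) :
    coordMeasure I (coefB m δ) (coordPair m I δ '' A)
      = ENNReal.ofReal (coefC m δ ^ 2 * (m + δ) * coefK m δ / 2) * reducedMeasure m I δ A := by
  have ha : 0 < m + δ := add_pos hm hδ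
  have hc := coefC_pos hm hδ
  have hk := coefK_pos hm hδ
  have hpair : coordPair m I δ '' A = splitEquiv '' (coordMap m I δ '' A) := by
    rw [image_image]
    refine image_congr fun x _ => ?_
    rw [splitEquiv_apply]
    rfl
  have hsub : coordPair m I δ '' A ∩ univ ×ˢ region I (coefB m δ) = coordPair m I δ '' A := by
    refine inter_eq_left.2 ?_
    rw [image_coordPair hm hI hδ hA]
    exact inter_subset_left
  have hcv := lintegral_image_eq_lintegral_abs_det_fderiv_mul volume hAm
    (fun x hx => (hasFDerivAt_coordMap hm hI hδ (hA hx)).hasFDerivWithinAt)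
    ((injOn_coordMap hm hI hδ).mono hA) (fun v => ENNReal.ofReal (v 5))
  have hsplit := measurePreserving_splitEquiv.setLIntegral_comp_emb
    splitEquiv.measurableEmbedding (fun p => ENNReal.ofReal (p.2 2)) (coordMap m I δ '' A)
  have hred : reducedMeasure m I δ A
      = ∫⁻ x in A, ENNReal.ofReal ((m + δ) * yCoord m I δ x) := by
    rw [reducedMeasure, withDensity_apply _ hAm, Measure.restrict_restrict hAm,
      inter_eq_left.2 hA]
    simp only [sqrt_det_inertia hm hδ]
  rw [coordMeasure_apply _ _ (measurableSet_image_coordPair hm hI hδ hA hAm), hsub, hpair,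
    ← hsplit, hred, ← lintegral_const_mul' _ _ ENNReal.ofReal_ne_top]
  simp only [splitEquiv_apply]
  refine hcv.trans (setLIntegral_congr_fun hAm fun x hx => ?_)
  have hy := yCoord_pos hm hI hδ (hA hx)
  have hdet : (LinearMap.toContinuousLinearMap (toLin' (coordJacobian m I δ x))).det
      = (coefC m δ * (m + δ)) ^ 2 * coefK m δ / 2 := by
    rw [← det_coordJacobian (I := I) hy.ne']
    simp [ContinuousLinearMap.det]
  have hpos : 0 < (coefC m δ * (m + δ)) ^ 2 * coefK m δ / 2 := by positivity
  have hv : coordMap m I δ x 5 = yCoord m I δ x := rfl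
  rw [hdet, abs_of_pos hpos, hv, ← ENNReal.ofReal_mul hpos.le, ← ENNReal.ofReal_mul (by positivity)]
  congr 1
  ring

theorem isInvariantMeasure_reducedMeasure (hm : 0 < m) (hI : 0 < I) (hδ : 0 < δ) :
    IsInvariantMeasure (reducedField m I δ) (phaseSpace δ) (reducedMeasure m I δ) := by
  intro A T Φ hAm hΦ
  have hB := coefB_pos hm hδ
  have hA : A ⊆ phaseSpace δ := fun x hx => by
    have : Φ 0 x ∈ phaseSpace δ := (hΦ x hx).2.2 0 left_mem_uIcc
    rwa [(hΦ x hx).1] at this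
  have himg : Φ T '' A = flow m I δ T '' A := image_congr fun x hx => by
    have := eq_flow_of_isSolutionOn hm hI hδ (hΦ x hx).2
    rwa [(hΦ x hx).1] at this
  rw [himg]
  have hA' : flow m I δ T '' A ⊆ phaseSpace δ := by
    rintro _ ⟨x, hx, rfl⟩
    exact flow_mem_phaseSpace hm hI hδ (hA hx) T
  have hAm' : MeasurableSet (flow m I δ T '' A) := by
    have : flow m I δ T '' A = phaseSpace δ ∩ flow m I δ (-T) ⁻¹' A := by
      ext x
      constructor
      · rintro ⟨x, hx, rfl⟩
        refine ⟨flow_mem_phaseSpace hm hI hδ (hA hx) T, ?_⟩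
        rwa [mem_preimage, flow_neg hm hI hδ (hA hx)]
      · rintro ⟨hx, hx'⟩
        exact ⟨_, hx', by simpa using flow_neg hm hI hδ hx (-T)⟩
    rw [this]
    exact (isOpen_phaseSpace δ).measurableSet.inter (measurable_flow hm hI hδ (-T) hAm)
  -- in the coordinates, the image under the flow is a preimage under the inverse flow
  set G : (Fin 3 → ℝ) × (Fin 3 → ℝ) → (Fin 3 → ℝ) × (Fin 3 → ℝ) :=
    fun p => (p.1, sliceFlow I (coefB m δ) (-T) p.1 p.2)
  have hG : MeasurePreserving G (coordMeasure I (coefB m δ)) (coordMeasure I (coefB m δ)) := by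
    have : SFinite (sliceMeasure I (coefB m δ)) := by unfold sliceMeasure; infer_instance
    exact (MeasurePreserving.id volume).skew_product (measurable_sliceFlow hI hB (-T))
      (Eventually.of_forall fun η => (measurePreserving_sliceFlow hI hB (-T) η).map_eq)
  have hDm := measurableSet_image_coordPair hm hI hδ hA hAm
  have hD : coordPair m I δ '' (flow m I δ T '' A)
      = (G ⁻¹' (coordPair m I δ '' A)) ∩ univ ×ˢ region I (coefB m δ) := by
    ext p
    constructor
    · rintro ⟨_, ⟨x, hx, rfl⟩, rfl⟩
      refine ⟨⟨x, hx, ?_⟩, coordPair_mem hm hI hδ (flow_mem_phaseSpace hm hI hδ (hA hx) T)⟩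
      simp only [G, coordPair, parPart_flow hm hI hδ (hA hx), posPart_flow hm hI hδ (hA hx),
        sliceFlow_neg hI hB (posPart_mem_region hm hI hδ (hA hx))]
    · rintro ⟨⟨x, hx, hxe⟩, -, hz⟩
      refine ⟨_, ⟨x, hx, rfl⟩, ?_⟩
      have h1 : parPart m I δ x = p.1 := congrArg Prod.fst hxe
      have h2 : posPart m I δ x = sliceFlow I (coefB m δ) (-T) p.1 p.2 := congrArg Prod.snd hxe
      rw [coordPair, parPart_flow hm hI hδ (hA hx), posPart_flow hm hI hδ (hA hx), h1, h2]
      exact Prod.ext rfl (by simpa using sliceFlow_neg hI hB hz (-T) p.1)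
  have hmeas : coordMeasure I (coefB m δ) (coordPair m I δ '' (flow m I δ T '' A))
      = coordMeasure I (coefB m δ) (coordPair m I δ '' A) := by
    have hGm := hG.measurable hDm
    have hR : MeasurableSet ((univ : Set (Fin 3 → ℝ)) ×ˢ region I (coefB m δ)) :=
      MeasurableSet.univ.prod (isOpen_region I _).measurableSet
    rw [← hG.measure_preimage hDm.nullMeasurableSet, hD, coordMeasure_apply _ _ hGm,
      coordMeasure_apply _ _ (hGm.inter hR), inter_assoc, inter_self]
  rw [coordMeasure_image hm hI hδ hA' hAm', coordMeasure_image hm hI hδ hA hAm] at hmeas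
  have hc := coefC_pos hm hδ
  have hk := coefK_pos hm hδ
  exact (ENNReal.mul_right_inj (ENNReal.ofReal_pos.2 (by positivity)).ne'
    ENNReal.ofReal_ne_top).1 hmeas

end Flow

/-! ### Solution by quadratures -/

namespace ByQuadratures

variable {n : ℕ} {x₀ : Fin n → ℝ} {t₀ : ℝ} {f g : ℝ → (Fin n → ℝ) → ℝ}

theorem neg (hf : ByQuadratures x₀ t₀ f) : ByQuadratures x₀ t₀ (fun t x => -f t x) :=
  ((const t₀ (-1)).mul hf).congr (Eventually.of_forall fun _ => by simp)

theorem sub (hf : ByQuadratures x₀ t₀ f) (hg : ByQuadratures x₀ t₀ g) :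
    ByQuadratures x₀ t₀ (fun t x => f t x - g t x) :=
  (hf.add hg.neg).congr (Eventually.of_forall fun _ => by simp [sub_eq_add_neg])

theorem sq (hf : ByQuadratures x₀ t₀ f) : ByQuadratures x₀ t₀ (fun t x => f t x ^ 2) :=
  (hf.mul hf).congr (Eventually.of_forall fun _ => by simp [pow_two])

theorem div (hf : ByQuadratures x₀ t₀ f) (hg : ByQuadratures x₀ t₀ g) (h : g t₀ x₀ ≠ 0) :
    ByQuadratures x₀ t₀ (fun t x => f t x / g t x) :=
  (hf.mul (hg.inv h)).congr (Eventually.of_forall fun _ => by simp [div_eq_mul_inv])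

/-- Square roots of positive functions are simple roots of `z² - f`. -/
theorem sqrt (hf : ByQuadratures x₀ t₀ f)
    (hc : ContinuousAt (fun p : ℝ × (Fin n → ℝ) => f p.1 p.2) (t₀, x₀)) (h : 0 < f t₀ x₀) :
    ByQuadratures x₀ t₀ (fun t x => √(f t x)) := by
  refine root 2 (a := fun i t x => if i = 0 then -f t x else if i = 2 then 1 else 0)
    (fun i => ?_) hc.sqrt ?_ ?_
  · by_cases h0 : i = 0
    · simpa [h0] using hf.neg
    · by_cases h2 : i = 2
      · simpa [h2] using const t₀ 1
      · simpa [h0, h2] using const t₀ 0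
  · filter_upwards [hc.eventually (lt_mem_nhds h)] with p hp
    simp [Finset.sum_range_succ, Real.sq_sqrt (le_of_lt hp)]
  · have := (Real.sqrt_pos.2 h).ne'
    simp [Finset.sum_range_succ, this]

end ByQuadratures

/-- `propS μ` inverts the integral of `(1 + μ τ²)^(-1/2)` as long as its derivative stays
positive. -/
theorem integral_propS {μ s : ℝ} (h : ∀ u ∈ uIcc 0 s, 0 < 1 + μ * propC μ u) :
    ∫ τ in (0 : ℝ)..propS μ s, (√(1 + μ * τ ^ 2))⁻¹ = s := by
  have hcC : Continuous (propC μ) :=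
    continuous_propC.comp (continuous_const.prodMk continuous_id)
  have hcS : Continuous (propS μ) :=
    continuous_propS.comp (continuous_const.prodMk continuous_id)
  have hcv := intervalIntegral.integral_comp_mul_deriv'' (a := 0) (b := s) (f := propS μ)
    (f' := fun u => 1 + μ * propC μ u) (g := fun τ => (√(1 + μ * τ ^ 2))⁻¹) hcS.continuousOn
    (fun u _ => (hasDerivAt_propS μ u).hasDerivWithinAt)
    (by fun_prop) (by
      rintro _ ⟨u, hu, rfl⟩
      have hpos : 0 < 1 + μ * propS μ u ^ 2 := by
        rw [← one_add_mul_propC_sq]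
        exact pow_pos (h u hu) 2
      refine ContinuousAt.continuousWithinAt (ContinuousAt.inv₀ ?_ (Real.sqrt_pos.2 hpos).ne')
      fun_prop)
  rw [propS_zero] at hcv
  rw [← hcv]
  have hone : ∀ u ∈ uIcc 0 s, ((fun τ => (√(1 + μ * τ ^ 2))⁻¹) ∘ propS μ) u *
      (1 + μ * propC μ u) = 1 := fun u hu => by
    simp only [Function.comp]
    rw [← one_add_mul_propC_sq, Real.sqrt_sq (h u hu).le, inv_mul_cancel₀ (h u hu).ne']
  rw [intervalIntegral.integral_congr hone]
  simp

section

variable {n : ℕ} {x₀ : Fin n → ℝ} {μ : (Fin n → ℝ) → ℝ}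

theorem byQuadratures_propS (hμ : ByQuadratures x₀ 0 (fun _ x => μ x)) (hc : ContinuousAt μ x₀) :
    ByQuadratures x₀ 0 (fun s x => propS (μ x) s) := by
  have hμc : ContinuousAt (fun p : ℝ × (Fin n → ℝ) => μ p.2) (0, x₀) :=
    ContinuousAt.comp (g := μ) (f := Prod.snd) (x := ((0 : ℝ), x₀)) hc continuousAt_snd
  have hpair : ContinuousAt (fun p : ℝ × (Fin n → ℝ) => (μ p.2, p.1)) (0, x₀) :=
    hμc.prodMk continuousAt_fst
  have hsqrt : ByQuadratures x₀ 0 (fun τ x => √(1 + μ x * τ ^ 2)) := by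
    refine (((ByQuadratures.const 0 1).add (hμ.mul (ByQuadratures.time 0).sq))).sqrt ?_ (by simp)
    exact continuousAt_const.add (hμc.mul (continuousAt_fst.pow 2))
  refine ByQuadratures.inverse (hsqrt.inv (by simp)).integral ?_ ?_ (propS_zero _) ?_
  · have hm : Measurable fun τ : ℝ => (√(1 + μ x₀ * τ ^ 2))⁻¹ := by fun_prop
    have hd : HasDerivAt (fun s => ∫ τ in (0 : ℝ)..s, (√(1 + μ x₀ * τ ^ 2))⁻¹)
        (√(1 + μ x₀ * 0 ^ 2))⁻¹ 0 := by
      refine intervalIntegral.integral_hasDerivAt_right (by simp)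
        hm.stronglyMeasurable.stronglyMeasurableAtFilter ?_
      exact ContinuousAt.inv₀ (by fun_prop) (by simp)
    rw [hd.deriv]
    simp
  · exact ContinuousAt.comp (g := fun p : ℝ × ℝ => propS p.1 p.2)
      continuous_propS.continuousAt hpair
  · have hC : ContinuousAt (fun p : ℝ × (Fin n → ℝ) => 1 + μ p.2 * propC (μ p.2) p.1) (0, x₀) :=
      continuousAt_const.add (hμc.mul
        (ContinuousAt.comp (g := fun p : ℝ × ℝ => propC p.1 p.2)
          continuous_propC.continuousAt hpair))
    have hpos := hC.eventually (lt_mem_nhds (by simp : (0 : ℝ) < 1 + μ x₀ * propC (μ x₀) 0))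
    -- on a product neighbourhood the derivative is positive on the whole interval from `0`
    obtain ⟨U, hU, V, hV, hUV⟩ := mem_nhds_prod_iff.1 hpos
    obtain ⟨ε, hε, hεU⟩ := Metric.mem_nhds_iff.1 hU
    filter_upwards [prod_mem_nhds (Metric.ball_mem_nhds (0 : ℝ) hε) hV] with p hp
    refine integral_propS fun u hu => ?_
    have h1 : |u - 0| ≤ |p.1 - 0| := abs_sub_left_of_mem_uIcc hu
    have h2 : |p.1| < ε := by simpa using hp.1
    simp only [sub_zero] at h1
    have hu' : u ∈ Metric.ball (0 : ℝ) ε := by simpa using h1.trans_lt h2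
    exact hUV (show (u, p.2) ∈ U ×ˢ V from ⟨hεU hu', hp.2⟩)

theorem byQuadratures_propC (hμ : ByQuadratures x₀ 0 (fun _ x => μ x)) (hc : ContinuousAt μ x₀) :
    ByQuadratures x₀ 0 (fun s x => propC (μ x) s) := by
  refine (byQuadratures_propS hμ hc).integral.congr (Eventually.of_forall fun p => ?_)
  have hcS : Continuous (propS (μ p.2)) :=
    continuous_propS.comp (continuous_const.prodMk continuous_id)
  rw [intervalIntegral.integral_eq_sub_of_hasDerivAt (fun u _ => hasDerivAt_propC (μ p.2) u)
    (hcS.intervalIntegrable _ _), propC_zero, sub_zero]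

theorem byQuadratures_gen_mulVec (B : ℝ) {t₀ : ℝ} {η ζ : (Fin n → ℝ) → Fin 3 → ℝ}
    (hη : ∀ i, ByQuadratures x₀ t₀ (fun _ x => η x i))
    (hζ : ∀ i, ByQuadratures x₀ t₀ (fun _ x => ζ x i)) (i : Fin 3) :
    ByQuadratures x₀ t₀ (fun _ x => (genMatrix B (η x) *ᵥ ζ x) i) := by
  simp only [genMatrix_mulVec]
  fin_cases i
  · exact ((hη 2).mul (hζ 1)).neg.sub ((hη 0).mul (hζ 2))
  · exact ((hη 2).mul (hζ 0)).sub ((hη 1).mul (hζ 2))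
  · exact ((ByQuadratures.const t₀ B).mul (((hη 0).mul (hζ 0)).add ((hη 1).mul (hζ 1)))).neg

/-- The linear system is solved by quadratures in the new time. -/
theorem byQuadratures_propagator (B : ℝ) {η ζ : (Fin n → ℝ) → Fin 3 → ℝ}
    (hη : ∀ i, ByQuadratures x₀ 0 (fun _ x => η x i))
    (hζ : ∀ i, ByQuadratures x₀ 0 (fun _ x => ζ x i)) (hc : ContinuousAt η x₀) (i : Fin 3) :
    ByQuadratures x₀ 0 (fun s x => (propagator B (η x) s *ᵥ ζ x) i) := by
  have hμ : ByQuadratures x₀ 0 (fun _ x => genDisc B (η x)) :=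
    ((ByQuadratures.const 0 B).mul ((hη 0).sq.add (hη 1).sq)).sub (hη 2).sq
  have hμc : ContinuousAt (fun x => genDisc B (η x)) x₀ :=
    (continuous_genDisc B).continuousAt.comp hc
  have h1 := byQuadratures_gen_mulVec B hη hζ
  have h2 := byQuadratures_gen_mulVec B hη h1
  simp only [propagator_mulVec, ← mulVec_mulVec]
  exact ((hζ i).add ((byQuadratures_propS hμ hμc).mul (h1 i))).add
    ((byQuadratures_propC hμ hμc).mul (h2 i))

theorem byQuadratures_elapsed (B : ℝ) {η ζ : (Fin n → ℝ) → Fin 3 → ℝ}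
    (hη : ∀ i, ByQuadratures x₀ 0 (fun _ x => η x i))
    (hζ : ∀ i, ByQuadratures x₀ 0 (fun _ x => ζ x i)) (hc : ContinuousAt η x₀) :
    ByQuadratures x₀ 0 (fun s x => elapsed B (η x) (ζ x) s) := by
  refine (byQuadratures_propagator B hη hζ hc 2).integral.congr
    (Eventually.of_forall fun p => ?_)
  have hcp : Continuous fun s => (propagator B (η p.2) s *ᵥ ζ p.2) 2 :=
    continuous_iff_continuousAt.2 fun u =>
      (hasDerivAt_pi.1 (hasDerivAt_propagator B (η p.2) (ζ p.2) u) 2).continuousAt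
  rw [intervalIntegral.integral_eq_sub_of_hasDerivAt
    (fun u _ => hasDerivAt_elapsed B (η p.2) (ζ p.2) u) (hcp.intervalIntegrable _ _),
    elapsed_zero, sub_zero]

theorem byQuadratures_innerTime {I₀ B : ℝ} (hI : 0 < I₀) (hB : 0 < B)
    {η ζ : (Fin n → ℝ) → Fin 3 → ℝ}
    (hη : ∀ i, ByQuadratures x₀ 0 (fun _ x => η x i))
    (hζ : ∀ i, ByQuadratures x₀ 0 (fun _ x => ζ x i)) (hc : ContinuousAt η x₀)
    (hmem : ∀ᶠ x in 𝓝 x₀, ζ x ∈ region I₀ B) :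
    ByQuadratures x₀ 0 (fun t x => innerTime I₀ B t (η x) (ζ x)) := by
  have hmem₀ := hmem.self_of_nhds
  have hmem' : ∀ᶠ p : ℝ × (Fin n → ℝ) in 𝓝 (0, x₀), ζ p.2 ∈ region I₀ B :=
    (continuousAt_snd (p := ((0 : ℝ), x₀))).eventually hmem
  refine ByQuadratures.inverse (byQuadratures_elapsed B hη hζ hc) ?_ ?_
    (innerTime_zero hI hB hmem₀ _) ?_
  · rw [(hasDerivAt_elapsed B (η x₀) (ζ x₀) 0).deriv]
    simpa using hmem₀.1.ne'
  · rw [ContinuousAt, innerTime_zero hI hB hmem₀, tendsto_zero_iff_abs_tendsto_zero]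
    have hlim : Tendsto (fun p : ℝ × (Fin n → ℝ) => |p.1| / √I₀) (𝓝 (0, x₀)) (𝓝 0) := by
      have : Continuous fun p : ℝ × (Fin n → ℝ) => |p.1| / √I₀ := by fun_prop
      simpa using this.tendsto (0, x₀)
    refine squeeze_zero' (Eventually.of_forall fun _ => abs_nonneg _) ?_ hlim
    filter_upwards [hmem'] with p hp
    simpa using abs_innerTime_sub_le hI hB hp p.1 (η p.2) 0
  · filter_upwards [hmem'] with p hp
    exact elapsed_innerTime hI hB hp p.1 (η p.2)

theorem byQuadratures_sliceFlow {I₀ B : ℝ} (hI : 0 < I₀) (hB : 0 < B)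
    {η ζ : (Fin n → ℝ) → Fin 3 → ℝ}
    (hη : ∀ i, ByQuadratures x₀ 0 (fun _ x => η x i))
    (hζ : ∀ i, ByQuadratures x₀ 0 (fun _ x => ζ x i)) (hc : ContinuousAt η x₀)
    (hmem : ∀ᶠ x in 𝓝 x₀, ζ x ∈ region I₀ B) (i : Fin 3) :
    ByQuadratures x₀ 0 (fun t x => sliceFlow I₀ B t (η x) (ζ x) i) := by
  refine ByQuadratures.comp (f := fun s x => (propagator B (η x) s *ᵥ ζ x) i)
    (byQuadratures_innerTime hI hB hη hζ hc hmem) ?_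
  rw [innerTime_zero hI hB hmem.self_of_nhds]
  exact byQuadratures_propagator B hη hζ hc i

end

section

variable {m I δ : ℝ}

theorem continuous_coordPair : Continuous (coordPair m I δ) := by
  have hy : Continuous (yCoord m I δ) := by unfold yCoord; fun_prop
  refine Continuous.prodMk (continuous_pi fun i => ?_) (continuous_pi fun i => ?_)
  · fin_cases i <;> simp [parPart, f₁, f₂] <;> fun_prop
  · fin_cases i <;> simp [posPart] <;> fun_prop

theorem byQuadratures_yCoord (hm : 0 < m) (hI : 0 < I) (hδ : 0 < δ) {x₀ : Fin 6 → ℝ}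
    (hx : x₀ ∈ phaseSpace δ) (t₀ : ℝ) : ByQuadratures x₀ t₀ (fun _ x => yCoord m I δ x) := by
  have hp := ByQuadratures.param (x₀ := x₀) t₀
  refine ((((ByQuadratures.const t₀ I).add (hp 5)).sub (((hp 3).sq.add (hp 4).sq).div
    (ByQuadratures.const t₀ (m + δ)) (add_pos hm hδ).ne'))).sqrt ?_ (radicand_pos hm hI hδ hx)
  fun_prop

theorem byQuadratures_posPart (hm : 0 < m) (hI : 0 < I) (hδ : 0 < δ) {x₀ : Fin 6 → ℝ}
    (hx : x₀ ∈ phaseSpace δ) (t₀ : ℝ) (i : Fin 3) :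
    ByQuadratures x₀ t₀ (fun _ x => posPart m I δ x i) := by
  have hp := ByQuadratures.param (x₀ := x₀) t₀
  fin_cases i
  exacts [hp 3, hp 4, byQuadratures_yCoord hm hI hδ hx t₀]

theorem byQuadratures_parPart (hm : 0 < m) (hI : 0 < I) (hδ : 0 < δ) {x₀ : Fin 6 → ℝ}
    (hx : x₀ ∈ phaseSpace δ) (t₀ : ℝ) (i : Fin 3) :
    ByQuadratures x₀ t₀ (fun _ x => parPart m I δ x i) := by
  have hp := ByQuadratures.param (x₀ := x₀) t₀
  have hk := ByQuadratures.const (x₀ := x₀) t₀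
  fin_cases i
  · exact (hk (coefC m δ)).mul (((hk (m + δ)).mul (hp 0)).sub ((hp 2).mul (hp 4)))
  · exact (hk (coefC m δ)).mul (((hk (m + δ)).mul (hp 1)).add ((hp 2).mul (hp 3)))
  · exact (hk (coefK m δ)).mul ((hp 2).mul (byQuadratures_yCoord hm hI hδ hx t₀))

theorem byQuadratures_ofCoords (hm : 0 < m) (hδ : 0 < δ) {n : ℕ} {x₀ : Fin n → ℝ} {t₀ : ℝ}
    {η ζ : ℝ → (Fin n → ℝ) → Fin 3 → ℝ} (hη : ∀ i, ByQuadratures x₀ t₀ (fun t x => η t x i))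
    (hζ : ∀ i, ByQuadratures x₀ t₀ (fun t x => ζ t x i)) (hy : ζ t₀ x₀ 2 ≠ 0) (i : Fin 6) :
    ByQuadratures x₀ t₀ (fun t x => ofCoords m I δ (η t x) (ζ t x) i) := by
  have ha : m + δ ≠ 0 := (add_pos hm hδ).ne'
  have hk := ByQuadratures.const (x₀ := x₀) t₀
  have hc0 := (coefC_pos hm hδ).ne'
  have hw := (hη 2).div ((hk (coefK m δ)).mul (hζ 2)) (mul_ne_zero (coefK_pos hm hδ).ne' hy)
  fin_cases i
  · exact (((hη 0).div (hk (coefC m δ)) hc0).add (hw.mul (hζ 1))).div (hk (m + δ)) ha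
  · exact (((hη 1).div (hk (coefC m δ)) hc0).sub (hw.mul (hζ 0))).div (hk (m + δ)) ha
  · exact hw
  · exact hζ 0
  · exact hζ 1
  · exact ((hζ 2).sq.sub (hk I)).add (((hζ 0).sq.add (hζ 1).sq).div (hk (m + δ)) ha)

theorem solvableByQuadratures_reducedField (hm : 0 < m) (hI : 0 < I) (hδ : 0 < δ) :
    SolvableByQuadratures (reducedField m I δ) (phaseSpace δ) := by
  intro x₀ hx₀
  have hB := coefB_pos hm hδ
  have hQ : ∀ᶠ x in 𝓝 x₀, x ∈ phaseSpace δ := (isOpen_phaseSpace δ).mem_nhds hx₀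
  have hη := byQuadratures_parPart hm hI hδ hx₀ 0
  refine ⟨flow m I δ, hQ.mono fun x hx => flow_zero hm hI hδ hx, ?_,
    byQuadratures_ofCoords hm hδ hη ?_ ?_⟩
  · filter_upwards [(continuousAt_snd (p := ((0 : ℝ), x₀))).eventually hQ] with p hp
    exact ⟨flow_mem_phaseSpace hm hI hδ hp p.1, hasDerivAt_flow hm hI hδ hp p.1⟩
  · exact byQuadratures_sliceFlow hI hB hη (byQuadratures_posPart hm hI hδ hx₀ 0)
      (continuous_fst.comp continuous_coordPair).continuousAt
      (hQ.mono fun x hx => posPart_mem_region hm hI hδ hx)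
  · exact (sliceFlow_mem_region hI hB (posPart_mem_region hm hI hδ hx₀) 0 _).1.ne'

end

end BallBearing

theorem theorem4 (m I δ : ℝ) (hm : 0 < m) (hI : 0 < I) (hδ : 0 < δ) :
    (BallBearing.IsFirstIntegral (BallBearing.reducedField m I δ) (BallBearing.phaseSpace δ)
        (BallBearing.f₁ m δ) ∧
      BallBearing.IsFirstIntegral (BallBearing.reducedField m I δ) (BallBearing.phaseSpace δ)
        (BallBearing.f₂ m δ) ∧
      BallBearing.IsFirstIntegral (BallBearing.reducedField m I δ) (BallBearing.phaseSpace δ)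
        (BallBearing.f₃ δ) ∧
      BallBearing.IsFirstIntegral (BallBearing.reducedField m I δ) (BallBearing.phaseSpace δ)
        (BallBearing.f₄ m I δ)) ∧
    BallBearing.FunctionallyIndependentOn
      ![BallBearing.f₁ m δ, BallBearing.f₂ m δ, BallBearing.f₃ δ, BallBearing.f₄ m I δ]
      (BallBearing.phaseSpace δ) ∧
    BallBearing.IsInvariantMeasure (BallBearing.reducedField m I δ) (BallBearing.phaseSpace δ)
      (BallBearing.reducedMeasure m I δ) ∧
    BallBearing.SolvableByQuadratures (BallBearing.reducedField m I δ)
      (BallBearing.phaseSpace δ) :=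
  ⟨⟨BallBearing.isFirstIntegral_f₁ hm hI hδ, BallBearing.isFirstIntegral_f₂ hm hI hδ,
    BallBearing.isFirstIntegral_f₃ hm hI hδ, BallBearing.isFirstIntegral_f₄ hm hI hδ⟩,
    BallBearing.functionallyIndependentOn hm hI hδ,
    BallBearing.isInvariantMeasure_reducedMeasure hm hI hδ,
    BallBearing.solvableByQuadratures_reducedField hm hI hδ⟩
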